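/- Let $k$ be an algebraically closed field and $A$ a finitely generated reduced $k$-algebra. A *degree-like function* on $A$ is a map $\delta : A\setminus\{0\}\to\mathbb Z\cup\{-\infty\}$, extended by $\delta(0)=-\infty$, such that $\delta(c)\le 0$ for $c\in k$; $\delta(f+g)\le\max\{\delta(f),\delta(g)\}$ for all $f,g$, with strict inequality only if $\delta(f)=\delta(g)$; and $\delta(fg)\le\delta(f)+\delta(g)$. It is *integer-valued* if $\delta(f)\ne-\infty$ for all $f\neq 0$. Put $F_i^\delta=\{f\in A:\delta(f)\le i\}$ and $A^\delta=\bigoplus_{i\in\mathbb Z}F_i^\delta\cong\sum_i F_i^\delta t^i\subseteq A[t,t^{-1}]$. We call $\delta$ *finitely generated* if $A^\delta$ is a finitely generated $k$-algebra, and *non-negative* if $F_i^\delta=0$ for all $i<0$. A *semidegree* is a degree-like function with $\delta(fg)=\delta(f)+\delta(g)$ for all $f,g$; a *quasidegree* is a degree-like function that is the pointwise maximum of finitely many (at least one) semidegrees. A degree-like function $\eta$ is *integral over* $\delta$ if $\eta\le\delta$ (so that $A^\delta\subseteq A^\eta$) and the ring $A^\eta$ is integral over $A^\delta$. If $\delta$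 is non-negative, then $P\mapsto\bigoplus_{d\ge 0}(P\cap F^\delta_d)$ defines $\psi_\delta:\operatorname{Spec}A\to\operatorname{Proj}A^\delta$; the points outside its image are the *points at infinity*. For non-negative $\delta,\eta$ we say that $\eta$ *preserves the intersections at infinity for* $\delta$ if, for all closed subsets $X_1,\dots,X_n$ of $\operatorname{Spec}A$ such that the closures of the $\psi_\delta(X_j)$ in $\operatorname{Proj}A^\delta$ have no common point at infinity, the closures of the $\psi_\eta(X_j)$ in $\operatorname{Proj}A^\eta$ have no common point at infinity either. **Theorem.** Let $\delta$ be a finitely generated integer-valued degree-like function on $A$. Then there are a positive integer $e$ and a finitely generated integer-valued quasidegree $\tilde\delta$ on $A$ that is integral over $e\delta$, and $$\tilde\delta(f)=e\lim_{m\to\infty}\frac{\delta(f^m)}{m}\qquad\text{for all } f\in A\setminus\{0\}$$ (in particular the limits exist). If $A$ is an integral domain, then $\tilde\delta$ is a maximum of finitely many integer-valued semidegrees. If $\delta$ is non-negative, then $\tilde\delta$ is also non-negative, and $\tilde\delta$ preserves the intersections at infinity for $\delta$. -/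

import Mathlib

noncomputable section

/-- A degree-like function on the `k`-algebra `A`: a map `A ∖ {0} → ℤ ∪ {-∞}`, extended by the
usual convention `δ(0) = -∞`; the element `⊥` of `WithBot ℤ` plays the role of `-∞`. -/
structure DegreeLike (k A : Type*) [Field k] [CommRing A] [Algebra k A] where
  toFun : A → WithBot ℤ
  apply_zero : toFun 0 = ⊥
  map_algebraMap_le : ∀ c : k, toFun (algebraMap k A c) ≤ 0
  map_add_le : ∀ f g : A, toFun (f + g) ≤ max (toFun f) (toFun g)
  eq_of_map_add_lt : ∀ f g : A, toFun (f + g) < max (toFun f) (toFun g) → toFun f = toFun g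
  map_mul_le : ∀ f g : A, toFun (f * g) ≤ toFun f + toFun g

namespace DegreeLike

variable {k A : Type*} [Field k] [CommRing A] [Algebra k A]

instance : CoeFun (DegreeLike k A) (fun _ => A → WithBot ℤ) := ⟨DegreeLike.toFun⟩

/-- The function takes integer values on nonzero elements. -/
def IsIntegerValued (δ : DegreeLike k A) : Prop := ∀ f : A, f ≠ 0 → δ f ≠ ⊥

/-- The `i`-th piece `F_i = {f : δ f ≤ i}` of the filtration that corresponds to `δ`. -/
def filt (δ : DegreeLike k A) (i : ℤ) : Submodule k A where
  carrier := {f | δ f ≤ (i : WithBot ℤ)}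
  zero_mem' := by
    change δ 0 ≤ _
    rw [δ.apply_zero]
    exact bot_le
  add_mem' {f g} hf hg := (δ.map_add_le f g).trans (max_le hf hg)
  smul_mem' c f hf := by
    change δ (c • f) ≤ _
    rw [Algebra.smul_def]
    refine (δ.map_mul_le _ _).trans ((add_le_add (δ.map_algebraMap_le c) hf).trans ?_)
    simp

theorem mem_filt (δ : DegreeLike k A) (i : ℤ) (f : A) :
    f ∈ δ.filt i ↔ δ f ≤ (i : WithBot ℤ) := Iff.rfl

theorem algebraMap_mem_filt (δ : DegreeLike k A) (c : k) : algebraMap k A c ∈ δ.filt 0 :=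
  δ.map_algebraMap_le c

theorem mul_mem_filt (δ : DegreeLike k A) {i j : ℤ} {f g : A} (hf : f ∈ δ.filt i)
    (hg : g ∈ δ.filt j) : f * g ∈ δ.filt (i + j) := by
  rw [mem_filt] at *
  rw [WithBot.coe_add]
  exact (δ.map_mul_le _ _).trans (add_le_add hf hg)

theorem filt_mono (δ : DegreeLike k A) {i j : ℤ} (h : i ≤ j) : δ.filt i ≤ δ.filt j :=
  fun _ hf => le_trans hf (WithBot.coe_le_coe.mpr h)

/-- `δ` is non-negative: `F_i = 0` for all `i < 0`. -/
def IsNonneg (δ : DegreeLike k A) : Prop := ∀ i : ℤ, i < 0 → δ.filt i = ⊥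

/-- The graded ring `A^δ = ⨁_{i ∈ ℤ} F_i`, realized as the subring `∑ F_i t^i` of the ring of
Laurent polynomials `A[t, t⁻¹]`. The element `(f)_d` is `f t^d`, and `(1)_1` is `t`. -/
def gradedRing (δ : DegreeLike k A) : Subalgebra k (LaurentPolynomial A) where
  carrier := {p | ∀ i : ℤ, p.coeff i ∈ δ.filt i}
  add_mem' {p q} hp hq i := by
    rw [AddMonoidAlgebra.coeff_add]
    exact (δ.filt i).add_mem (hp i) (hq i)
  mul_mem' {p q} hp hq i := by
    classical
    rw [AddMonoidAlgebra.coeff_mul]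
    refine Submodule.sum_mem _ fun a _ => Submodule.sum_mem _ fun b _ => ?_
    dsimp only
    split_ifs with h
    · rw [← h]
      exact δ.mul_mem_filt (hp a) (hq b)
    · exact Submodule.zero_mem _
  algebraMap_mem' c i := by
    classical
    change (AddMonoidAlgebra.single (0 : ℤ) (algebraMap k A c)).coeff i ∈ _
    rw [AddMonoidAlgebra.coeff_single, Finsupp.single_apply]
    split_ifs with h
    · rw [← h]
      exact δ.algebraMap_mem_filt c
    · exact Submodule.zero_mem _

theorem mem_gradedRing (δ : DegreeLike k A) (p : LaurentPolynomial A) :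
    p ∈ δ.gradedRing ↔ ∀ i : ℤ, p.coeff i ∈ δ.filt i := Iff.rfl

theorem single_mem_gradedRing (δ : DegreeLike k A) {d : ℤ} {f : A} (hf : f ∈ δ.filt d) :
    (AddMonoidAlgebra.single d f : LaurentPolynomial A) ∈ δ.gradedRing := by
  classical
  intro i
  rw [AddMonoidAlgebra.coeff_single, Finsupp.single_apply]
  split_ifs with h
  · rwa [← h]
  · exact Submodule.zero_mem _

/-- `δ` is finitely generated: `A^δ` is a finitely generated `k`-algebra. -/
def IsFinitelyGenerated (δ : DegreeLike k A) : Prop := Algebra.FiniteType k δ.gradedRing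

/-- Semidegrees are the multiplicative degree-like functions. -/
def IsSemidegree (δ : DegreeLike k A) : Prop := ∀ f g : A, δ (f * g) = δ f + δ g

/-- `δ` is the pointwise maximum of `σ_1, …, σ_N`. -/
def IsMaxOf (δ : DegreeLike k A) {N : ℕ} (σ : Fin N → DegreeLike k A) : Prop :=
  ∀ f : A, δ f = Finset.univ.sup fun i => σ i f

/-- A quasidegree is the maximum of finitely many (and at least one) semidegrees. -/
def IsQuasidegree (δ : DegreeLike k A) : Prop :=
  ∃ (N : ℕ) (σ : Fin N → DegreeLike k A), 0 < N ∧ (∀ i, (σ i).IsSemidegree) ∧ δ.IsMaxOf σ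

/-- A quasidegree that is the maximum of finitely many integer-valued semidegrees. -/
def IsIntegerQuasidegree (δ : DegreeLike k A) : Prop :=
  ∃ (N : ℕ) (σ : Fin N → DegreeLike k A), 0 < N ∧
    (∀ i, (σ i).IsSemidegree ∧ (σ i).IsIntegerValued) ∧ δ.IsMaxOf σ

/-- Multiplication by a positive integer on `ℤ ∪ {-∞}`, with `e · (-∞) = -∞`. -/
def scale (e : ℕ) (x : WithBot ℤ) : WithBot ℤ := x.map fun d => (e : ℤ) * d

theorem scale_strictMono {e : ℕ} (he : 0 < e) : StrictMono (scale e) := by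
  have h : StrictMono fun d : ℤ => (e : ℤ) * d := fun a b hab => by
    have : (0 : ℤ) < e := by exact_mod_cast he
    exact mul_lt_mul_of_pos_left hab this
  exact WithBot.strictMono_map_iff.mpr h

theorem scale_add (e : ℕ) (x y : WithBot ℤ) : scale e (x + y) = scale e x + scale e y := by
  induction x with
  | bot => simp [scale]
  | coe a =>
    induction y with
    | bot => simp [scale]
    | coe b =>
      change (((e : ℤ) * (a + b) : ℤ) : WithBot ℤ) = (((e : ℤ) * a + (e : ℤ) * b : ℤ) : WithBot ℤ)
      rw [mul_add]

/-- The degree-like function `e δ`, for a positive integer `e`. -/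
def mul (e : ℕ) (he : 0 < e) (δ : DegreeLike k A) : DegreeLike k A where
  toFun f := scale e (δ f)
  apply_zero := by rw [δ.apply_zero]; rfl
  map_algebraMap_le c := by
    have h := (scale_strictMono he).monotone (δ.map_algebraMap_le c)
    have h0 : scale e 0 = 0 := by
      change ((((e : ℤ) * 0 : ℤ)) : WithBot ℤ) = 0
      simp
    rwa [h0] at h
  map_add_le f g := by
    rw [← (scale_strictMono he).monotone.map_max]
    exact (scale_strictMono he).monotone (δ.map_add_le f g)
  eq_of_map_add_lt f g h := by
    rw [← (scale_strictMono he).monotone.map_max] at h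
    rw [δ.eq_of_map_add_lt f g ((scale_strictMono he).lt_iff_lt.mp h)]
  map_mul_le f g := by
    rw [← scale_add]
    exact (scale_strictMono he).monotone (δ.map_mul_le f g)

/-- `η` is integral over `δ`: `η ≤ δ`, so that `A^δ ⊆ A^η`, and the ring `A^η` is integral over
`A^δ`. -/
def IsIntegralOver (η δ : DegreeLike k A) : Prop :=
  (∀ f : A, η f ≤ δ f) ∧ ∀ x ∈ η.gradedRing, IsIntegral δ.gradedRing x

/-- The degree `d` part of `A^δ`, namely `F_d t^d`. -/
def piece (δ : DegreeLike k A) (d : ℕ) : Submodule k δ.gradedRing where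
  carrier := {x | ∀ i : ℤ, i ≠ d → x.1.coeff i = 0}
  zero_mem' i _ := by simp
  add_mem' {x y} hx hy i hi := by
    change (x.1 + y.1).coeff i = 0
    rw [AddMonoidAlgebra.coeff_add]
    change x.1.coeff i + y.1.coeff i = 0
    rw [hx i hi, hy i hi, add_zero]
  smul_mem' c x hx i hi := by
    change (c • x.1).coeff i = 0
    rw [AddMonoidAlgebra.coeff_smul]
    change c • x.1.coeff i = 0
    rw [hx i hi, smul_zero]

theorem mem_piece (δ : DegreeLike k A) (d : ℕ) (x : δ.gradedRing) :
    x ∈ δ.piece d ↔ ∀ i : ℤ, i ≠ d → x.1.coeff i = 0 := Iff.rfl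

/-- The element `(f)_d = f t^d` of `A^δ`, for `f ∈ F_d`. -/
def elem (δ : DegreeLike k A) (d : ℕ) (f : A) (hf : f ∈ δ.filt d) : δ.piece d :=
  ⟨⟨AddMonoidAlgebra.single (d : ℤ) f, δ.single_mem_gradedRing hf⟩, fun i hi => by
    classical
    change (AddMonoidAlgebra.single (d : ℤ) f).coeff i = 0
    rw [AddMonoidAlgebra.coeff_single, Finsupp.single_apply, if_neg hi.symm]⟩

theorem coeff_coeAddMonoidHom_piece (δ : DegreeLike k A) (y : DirectSum ℕ fun d => δ.piece d)
    (d : ℕ) : (DirectSum.coeAddMonoidHom δ.piece y).1.coeff d = (y d).1.1.coeff d := by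
  classical
  induction y using DirectSum.induction_on with
  | zero => rw [map_zero]; rfl
  | of i x =>
    rw [DirectSum.coeAddMonoidHom_of]
    by_cases h : i = d
    · subst h
      rw [DirectSum.of_eq_same]
    · rw [DirectSum.of_eq_of_ne _ _ _ (Ne.symm h)]
      exact x.2 d (by exact_mod_cast Ne.symm h)
  | add y z hy hz =>
    rw [map_add, DirectSum.add_apply]
    exact congrArg₂ (· + ·) hy hz

theorem coeff_eq_zero_of_neg (δ : DegreeLike k A) (h : δ.IsNonneg) (x : δ.gradedRing) (i : ℤ)
    (hi : i < 0) : x.1.coeff i = 0 := by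
  have := x.2 i
  rw [h i hi] at this
  exact this

theorem isInternal_piece (δ : DegreeLike k A) (h : δ.IsNonneg) :
    DirectSum.IsInternal δ.piece := by
  classical
  constructor
  · intro y z hyz
    refine DFinsupp.ext fun d => Subtype.ext (Subtype.ext (LaurentPolynomial.ext fun i => ?_))
    by_cases hi : i = d
    · subst hi
      rw [← δ.coeff_coeAddMonoidHom_piece y d, hyz, δ.coeff_coeAddMonoidHom_piece z d]
    · exact ((y d).2 i hi).trans ((z d).2 i hi).symm
  · intro x
    refine ⟨∑ d ∈ x.1.coeff.support.image Int.toNat,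
      DirectSum.of (fun d => δ.piece d) d (δ.elem d (x.1.coeff d) (x.2 d)), ?_⟩
    refine Subtype.ext (LaurentPolynomial.ext fun i => ?_)
    rcases lt_or_ge i 0 with hi | hi
    · rw [δ.coeff_eq_zero_of_neg h _ i hi, δ.coeff_eq_zero_of_neg h _ i hi]
    · lift i to ℕ using hi
      rw [coeff_coeAddMonoidHom_piece, DFinsupp.finsetSum_apply]
      by_cases hx : x.1.coeff (i : ℤ) = 0
      · rw [hx, Finset.sum_eq_zero]
        · rfl
        · intro d _
          by_cases hd : d = i
          · subst hd
            refine (DirectSum.of_eq_same d _).trans ?_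
            refine Subtype.ext (Subtype.ext ?_)
            change AddMonoidAlgebra.single (d : ℤ) (x.1.coeff (d : ℤ)) = 0
            rw [hx, AddMonoidAlgebra.single_zero]
          · exact DirectSum.of_eq_of_ne _ _ _ (Ne.symm hd)
      · rw [Finset.sum_eq_single i]
        · refine (congrArg (fun z : δ.piece i => z.1.1.coeff (i : ℤ))
            (DirectSum.of_eq_same i _)).trans ?_
          change (AddMonoidAlgebra.single (i : ℤ) (x.1.coeff (i : ℤ))).coeff (i : ℤ) = _
          rw [AddMonoidAlgebra.coeff_single, Finsupp.single_eq_same]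
        · intro d _ hd
          exact DirectSum.of_eq_of_ne _ _ _ (Ne.symm hd)
        · intro hn
          exfalso
          exact hn (Finset.mem_image.mpr ⟨(i : ℤ), Finsupp.mem_support_iff.mpr hx, by simp⟩)

instance gradedMonoid_piece (δ : DegreeLike k A) : SetLike.GradedMonoid δ.piece where
  one_mem := by
    classical
    intro i hi
    change (AddMonoidAlgebra.single (0 : ℤ) (1 : A)).coeff i = 0
    rw [AddMonoidAlgebra.coeff_single, Finsupp.single_apply, if_neg]
    exact fun hh => hi (by rw [← hh]; rfl)
  mul_mem d e x y hx hy i hi := by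
    classical
    change (x.1 * y.1).coeff i = 0
    rw [AddMonoidAlgebra.coeff_mul]
    refine Finset.sum_eq_zero fun a _ => Finset.sum_eq_zero fun b _ => ?_
    dsimp only
    split_ifs with hab
    · by_cases ha : a = d
      · have hb : b ≠ e := by
          rintro rfl
          exact hi (by rw [← hab, ha]; push_cast; rfl)
        rw [hy b hb, mul_zero]
      · rw [hx a ha, zero_mul]
    · rfl

/-- If `δ` is non-negative, then `A^δ` is graded by its pieces of degrees `0, 1, 2, …`. -/
@[reducible]
def gradedAlgebra (δ : DegreeLike k A) (h : δ.IsNonneg) : GradedAlgebra δ.piece :=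
  { δ.gradedMonoid_piece, (δ.isInternal_piece h).chooseDecomposition with }

/-- The space `X^δ = Proj A^δ` of relevant homogeneous prime ideals of `A^δ`, with the Zariski
topology. -/
abbrev ProjSpace (δ : DegreeLike k A) (h : δ.IsNonneg) : Type _ :=
  @ProjectiveSpectrum δ.gradedRing (Submodule k δ.gradedRing) _ _ _ δ.piece (δ.gradedAlgebra h)

instance (δ : DegreeLike k A) (h : δ.IsNonneg) : TopologicalSpace (δ.ProjSpace h) :=
  letI := δ.gradedAlgebra h
  inferInstanceAs (TopologicalSpace (ProjectiveSpectrum δ.piece))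

/-- The homogenization `⨁ (I ∩ F_d)` of an ideal `I` of `A`, as an ideal of `A^δ`. -/
def homogenization (δ : DegreeLike k A) (I : Ideal A) : Ideal δ.gradedRing where
  carrier := {x | ∀ i : ℤ, x.1.coeff i ∈ I}
  zero_mem' i := I.zero_mem
  add_mem' {x y} hx hy i := I.add_mem (hx i) (hy i)
  smul_mem' c x hx i := by
    classical
    change (c.1 * x.1).coeff i ∈ I
    rw [AddMonoidAlgebra.coeff_mul]
    refine Submodule.sum_mem _ fun a _ => Submodule.sum_mem _ fun b _ => ?_
    dsimp only
    split_ifs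
    · exact I.mul_mem_left _ (hx b)
    · exact I.zero_mem

theorem mem_homogenization (δ : DegreeLike k A) (I : Ideal A) (x : δ.gradedRing) :
    x ∈ δ.homogenization I ↔ ∀ i : ℤ, x.1.coeff i ∈ I := Iff.rfl

theorem homogenization_isPrime (δ : DegreeLike k A) (P : Ideal A) [hP : P.IsPrime] :
    (δ.homogenization P).IsPrime := by
  have key : δ.homogenization P = RingHom.ker
      ((AddMonoidAlgebra.mapRingHom ℤ (Ideal.Quotient.mk P)).comp
        δ.gradedRing.val.toRingHom) := by
    ext x
    rw [mem_homogenization, RingHom.mem_ker]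
    refine ⟨fun hx => LaurentPolynomial.ext fun i => ?_, fun hx i => ?_⟩
    · change Ideal.Quotient.mk P (x.1.coeff i) = 0
      exact Ideal.Quotient.eq_zero_iff_mem.mpr (hx i)
    · have := congrArg (fun z : LaurentPolynomial (A ⧸ P) => z.coeff i) hx
      exact Ideal.Quotient.eq_zero_iff_mem.mp this
  rw [key]
  exact RingHom.ker_isPrime _

theorem homogenization_isHomogeneous (δ : DegreeLike k A) (h : δ.IsNonneg) (I : Ideal A) :
    letI := δ.gradedAlgebra h
    (δ.homogenization I).IsHomogeneous δ.piece := by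
  let _ := δ.gradedAlgebra h
  intro d x hx i
  by_cases hi : i = d
  · subst hi
    have h1 := δ.coeff_coeAddMonoidHom_piece (DirectSum.decompose δ.piece x) d
    have h2 : DirectSum.coeAddMonoidHom δ.piece (DirectSum.decompose δ.piece x) = x :=
      (DirectSum.decompose δ.piece).symm_apply_apply x
    rw [h2] at h1
    rw [← h1]
    exact hx d
  · rw [(DirectSum.decompose δ.piece x d).2 i hi]
    exact I.zero_mem

theorem irrelevant_not_le (δ : DegreeLike k A) (h : δ.IsNonneg) (P : Ideal A) [hP : P.IsPrime] :
    letI := δ.gradedAlgebra h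
    ¬ (HomogeneousIdeal.irrelevant δ.piece).toIdeal ≤ δ.homogenization P := by
  let _ := δ.gradedAlgebra h
  intro hle
  have h1 : (1 : A) ∈ δ.filt ((1 : ℕ) : ℤ) := by
    have h0 := δ.algebraMap_mem_filt 1
    rw [_root_.map_one] at h0
    exact δ.filt_mono (by simp) h0
  have ht : (δ.elem 1 1 h1 : δ.gradedRing) ∈ (HomogeneousIdeal.irrelevant δ.piece).toIdeal :=
    HomogeneousIdeal.mem_irrelevant_of_mem δ.piece Nat.one_pos (δ.elem 1 1 h1).2
  have h2 := hle ht ((1 : ℕ) : ℤ)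
  have h3 : ((δ.elem 1 1 h1 : δ.gradedRing).1.coeff ((1 : ℕ) : ℤ)) = 1 := by
    change (AddMonoidAlgebra.single ((1 : ℕ) : ℤ) (1 : A)).coeff ((1 : ℕ) : ℤ) = 1
    rw [AddMonoidAlgebra.coeff_single, Finsupp.single_eq_same]
  rw [h3] at h2
  exact hP.ne_top ((Ideal.eq_top_iff_one P).mpr h2)

/-- The point `⨁ (P ∩ F_d)` of `Proj A^δ` for a prime ideal `P` of `A`. This is the open immersion
`ψ_δ : Spec A → Proj A^δ` on points. -/
def psi (δ : DegreeLike k A) (h : δ.IsNonneg) (P : PrimeSpectrum A) : δ.ProjSpace h :=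
  letI := δ.gradedAlgebra h
  { asHomogeneousIdeal :=
      ⟨δ.homogenization P.asIdeal, δ.homogenization_isHomogeneous h P.asIdeal⟩
    isPrime := δ.homogenization_isPrime P.asIdeal
    not_irrelevant_le := fun hle => δ.irrelevant_not_le h P.asIdeal hle }

/-- The set `X_∞ = Proj A^δ ∖ Spec A` of points at infinity. -/
def pointsAtInfinity (δ : DegreeLike k A) (h : δ.IsNonneg) : Set (δ.ProjSpace h) :=
  (Set.range (δ.psi h))ᶜ

/-- The closures in `Proj A^δ` of the subsets `X_1, …, X_n` of `Spec A` have no common point at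
infinity. -/
def NoCommonPointAtInfinity (δ : DegreeLike k A) (h : δ.IsNonneg) {n : ℕ}
    (X : Fin n → Set (PrimeSpectrum A)) : Prop :=
  (⋂ j, closure (δ.psi h '' X j)) ∩ δ.pointsAtInfinity h = ∅

/-- `η` preserves the intersections at infinity for `δ`. -/
def PreservesIntersectionsAtInfinity (η δ : DegreeLike k A) (hη : η.IsNonneg)
    (hδ : δ.IsNonneg) : Prop :=
  ∀ (n : ℕ) (X : Fin n → Set (PrimeSpectrum A)), (∀ j, IsClosed (X j)) →
    δ.NoCommonPointAtInfinity hδ X → η.NoCommonPointAtInfinity hη X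

end DegreeLike

end

/-!
Write `t` for the element `(1)_1` of `A^δ ⊆ A[t, t⁻¹]`. The function `η` is read off from the integral
closure `B` of `A^δ` in `A[t, t⁻¹]`.

*Finiteness.* `B` is a finite `A^δ`-module. By reducedness, `A[t, t⁻¹]` embeds into the product of the
domains `(A/P)[t, t⁻¹]` for the minimal primes `P`, so this comes down to the finiteness of the
integral closure of a finitely generated domain over a perfect infinite field in its fraction field.
That follows from a separable Noether normalization
(`exists_algebraicIndependent_isIntegral_isSeparable`): starting from a relation of least degree
between the generators, which has a nonzero partial derivative, a generic linear change of variables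
makes one generator both integral and separable over the others.

*Rees valuations.* For each `P` the integral closure `C` in the domain `(A/P)[t, t⁻¹]` is Noetherian
and integrally closed in `C[t⁻¹]`, so its localizations at the associated primes of `t` are discrete
valuation rings, and these finitely many valuations decide divisibility by powers of `t`
(`exists_finite_valuations_pow_dvd`). Hence `f t^i ∈ B` holds if and only if `v(f) + i v(t) ≥ 0` for
finitely many discrete valuations `v`, all positive at `t` (`exists_valuations_isIntegral_single_iff`).
If `e` is a common multiple of the values `v(t)`, then the semidegrees `σ_v = -(e / v(t)) v` are
integral, and their maximum `η` satisfies `η f ≤ e i ↔ f t^i ∈ B`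
(`DegreeLike.exists_finMax_le_iff_isIntegral`).

*Comparison.* Since `A^δ ⊆ B`, `η ≤ e δ`. As `B` is finite over `A^δ`, some `t^c B` lies in `A^δ`, which
gives `e δ ≤ η + e (c + 1)`. A maximum of semidegrees satisfies `η(f^m) = m η(f)`, so the bounds
`m η(f) ≤ e δ(f^m) ≤ m η(f) + N` give the limit formula, integer values and non-negativity; and `A^η`
is isomorphic to an ideal of the Noetherian ring `A^{eδ}`, which gives integrality and finite
generation.

*Intersections at infinity.* The substitution `t ↦ t^e` maps `A^δ` into `A^{eδ} ⊆ A^η`, and contraction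
along it sends points of `Proj A^η` to relevant primes, since the irrelevant ideal of `A^η` is
integral over that of `A^{eδ}`. A point is at infinity exactly when it contains `t`, so contraction
sends points at infinity to points at infinity; it sends the closure of `ψ_η(X)` into that of
`ψ_δ(X)`. A common point at infinity for `η` therefore yields one for `δ`
(`DegreeLike.preservesIntersectionsAtInfinity_of_isIntegralOver`).
-/

/-! ### Separable Noether normalization -/

open MvPolynomial in
theorem MvPolynomial.totalDegree_pderiv_lt {σ R : Type*} [CommSemiring R] {F : MvPolynomial σ R}
    {i : σ} (h : pderiv i F ≠ 0) : (pderiv i F).totalDegree < F.totalDegree := by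
  have key : ∀ m ∈ (pderiv i F).support, m.degree + 1 ≤ F.totalDegree := by
    intro m hm
    rw [mem_support_iff, coeff_pderiv] at hm
    have h1 : (m + Finsupp.single i 1).degree ≤ F.totalDegree :=
      le_totalDegree (mem_support_iff.mpr (left_ne_zero_of_mul hm))
    simpa using h1
  obtain ⟨m, hm⟩ := support_nonempty.mpr h
  have hpos : 0 < F.totalDegree := by have := key m hm; omega
  rw [totalDegree, Finset.sup_lt_iff hpos]
  exact fun m hm => key m hm

open MvPolynomial in
/-- Over a perfect field, a relation of least degree between algebraically dependent elements is not
killed by all partial derivatives at these elements: in characteristic `p` some exponent is prime to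
`p`, and the corresponding derivative is a nonzero polynomial of smaller degree. -/
theorem exists_relation_aeval_pderiv_ne_zero {k K ι : Type*} [Field k] [PerfectField k] [Field K]
    [Algebra k K] {x : ι → K} (hx : ¬ AlgebraicIndependent k x) :
    ∃ F : MvPolynomial ι k, F ≠ 0 ∧ aeval x F = 0 ∧ ∃ i, aeval x (pderiv i F) ≠ 0 := by
  classical
  set S := {F : MvPolynomial ι k | F ≠ 0 ∧ F.aeval x = 0}
  obtain ⟨F, ⟨hF₀, hFa⟩, hFmin⟩ :
      ∃ F ∈ S, ∀ G : MvPolynomial ι k, G ≠ 0 → G.aeval x = 0 →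
        totalDegree F ≤ totalDegree G := by
    suffices S.Nonempty from
      ⟨totalDegree.argminOn S this, totalDegree.argminOn_mem ..,
        fun _ h₁ h₂ ↦ totalDegree.argminOn_le S ⟨h₁, h₂⟩⟩
    simpa [S, algebraicIndependent_iff, and_comm, Set.Nonempty] using hx
  refine ⟨F, hF₀, hFa, ?_⟩
  -- an exponent that is nonzero in `k` makes a derivative nonzero, and minimality does the rest
  suffices h : ∃ i, ∃ σ ∈ F.support, ((σ i : ℕ) : k) ≠ 0 by
    obtain ⟨i, σ, hσ, hi⟩ := h
    have hd : pderiv i F ≠ 0 := by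
      intro h0
      have hi0 : σ i ≠ 0 := fun h => hi (by simp [h])
      have h1 := coeff_pderiv (i := i) F (σ - Finsupp.single i 1)
      have h2 : σ - Finsupp.single i 1 + Finsupp.single i 1 = σ :=
        tsub_add_cancel_of_le (by simpa [Nat.one_le_iff_ne_zero] using hi0)
      rw [h0, coeff_zero, h2] at h1
      have h3 : (((σ - Finsupp.single i 1 : ι →₀ ℕ) i : ℕ) : k) + 1 = (σ i : k) := by
        have h4 : (σ - Finsupp.single i 1 : ι →₀ ℕ) i + 1 = σ i := by
          simp only [Finsupp.coe_tsub, Pi.sub_apply, Finsupp.single_eq_same]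
          omega
        rw [← h4, Nat.cast_succ]
      rw [h3] at h1
      exact mul_ne_zero (mem_support_iff.mp hσ) hi h1.symm
    exact ⟨i, fun h => (totalDegree_pderiv_lt hd).not_ge (hFmin _ hd h)⟩
  obtain _ | ⟨p, hp, hpk⟩ := CharP.exists' k
  · by_contra! hcon
    have hc : F = C (coeff 0 F) := by
      rw [← totalDegree_eq_zero_iff_eq_C, totalDegree_eq_zero_iff]
      intro σ hσ i
      simpa using hcon i σ hσ
    rw [hc, aeval_C, map_eq_zero] at hFa
    rw [hFa, C_0] at hc
    exact hF₀ hc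
  · have : ExpChar k p := .prime hp.out
    have : CharP K p := .of_ringHom_of_ne_zero (algebraMap k K) p hp.out.ne_zero
    obtain ⟨i, σ, hσ, hi⟩ := exists_mem_support_not_dvd_of_forall_totalDegree_le (k := k) p hp.out
      (fun s hs => by
        apply hs.map_of_injective_injective (frobeniusEquiv k p).symm
          (frobenius K p).toAddMonoidHom
        · simp
        · simp
        · intro r m
          change ((frobeniusEquiv k p).symm r • m) ^ p = r • m ^ p
          rw [Algebra.smul_def, mul_pow, ← map_pow, frobeniusEquiv_symm_pow_p,
            ← Algebra.smul_def])
      hFmin hF₀ hFa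
    exact ⟨i, σ, hσ, by rwa [Ne, CharP.cast_eq_zero_iff k p]⟩

open MvPolynomial in
theorem Polynomial.derivative_mvPolynomial_aeval {k R ι : Type*} [Field k] [CommRing R]
    [Algebra k R] [Fintype ι] (g : ι → Polynomial R) (F : MvPolynomial ι k) :
    derivative (MvPolynomial.aeval g F) =
      ∑ i, MvPolynomial.aeval g (pderiv i F) * derivative (g i) := by
  classical
  induction F using MvPolynomial.induction_on with
  | C a => simp [Polynomial.algebraMap_apply]
  | add p q hp hq => simp [hp, hq, add_mul, Finset.sum_add_distrib]
  | mul_X p i hp =>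
    have h1 : ∀ j, MvPolynomial.aeval g (pderiv j (p * MvPolynomial.X i)) * derivative (g j) =
        MvPolynomial.aeval g (pderiv j p) * derivative (g j) * g i +
          (if i = j then MvPolynomial.aeval g p * derivative (g j) else 0) := by
      intro j
      rw [pderiv_mul, map_add, map_mul, map_mul, MvPolynomial.aeval_X]
      split_ifs with h
      · rw [← h, pderiv_X_self, map_one]; ring
      · rw [pderiv_X_of_ne h, map_zero]; ring
    rw [map_mul, MvPolynomial.aeval_X, derivative_mul, hp, Finset.sum_congr rfl fun j _ => h1 j,
      Finset.sum_add_distrib, Finset.sum_ite_eq, if_pos (Finset.mem_univ _), Finset.sum_mul]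

open MvPolynomial in
/-- Substituting linear polynomials `a i + b i X` into a polynomial of total degree `d` gives a
polynomial of degree at most `d` whose coefficient of degree `d` is the value at `b` of the
leading form. -/
theorem Polynomial.natDegree_aeval_linear_le {k R ι : Type*} [Field k] [CommRing R]
    [Algebra k R] [Fintype ι] (a : ι → R) (b : ι → k) (F : MvPolynomial ι k) :
    (MvPolynomial.aeval (fun i => C (a i) + C (algebraMap k R (b i)) * X) F).natDegree
        ≤ F.totalDegree ∧
      (MvPolynomial.aeval (fun i => C (a i) + C (algebraMap k R (b i)) * X) F).coeff F.totalDegree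
        = algebraMap k R (MvPolynomial.eval b (homogeneousComponent F.totalDegree F)) := by
  classical
  set l : ι → Polynomial R := fun i => C (a i) + C (algebraMap k R (b i)) * X with hl
  have hl1 : ∀ i, (l i).natDegree ≤ 1 := fun i => by
    rw [hl]; dsimp only; rw [add_comm]; exact natDegree_linear_le
  have hl2 : ∀ i, (l i).coeff 1 = algebraMap k R (b i) := fun i => by simp [hl]
  have hprod : ∀ (v : ι →₀ ℕ) (s : Finset ι), (∏ i ∈ s, l i ^ v i).natDegree ≤ ∑ i ∈ s, v i ∧
      (∏ i ∈ s, l i ^ v i).coeff (∑ i ∈ s, v i) = ∏ i ∈ s, algebraMap k R (b i) ^ v i := by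
    intro v s
    induction s using Finset.induction_on with
    | empty => simp
    | insert i s hi ih =>
      have h1 : (l i ^ v i).natDegree ≤ v i := by
        simpa using natDegree_pow_le_of_le (v i) (hl1 i)
      rw [Finset.prod_insert hi, Finset.sum_insert hi, Finset.prod_insert hi]
      refine ⟨natDegree_mul_le_of_le h1 ih.1, ?_⟩
      rw [coeff_mul_add_eq_of_natDegree_le h1 ih.1, ih.2]
      have h2 := coeff_pow_of_natDegree_le (m := v i) (hl1 i)
      rw [mul_one, hl2] at h2
      rw [h2]
  have hF : MvPolynomial.aeval l F =
      ∑ v ∈ F.support, C (algebraMap k R (MvPolynomial.coeff v F)) * ∏ i, l i ^ v i := by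
    rw [MvPolynomial.aeval_def, MvPolynomial.eval₂_eq']
    rfl
  have hdeg : ∀ v ∈ F.support, v.degree ≤ F.totalDegree := fun v hv => le_totalDegree hv
  simp only [Finsupp.degree_eq_sum] at hdeg
  rw [hF]
  constructor
  · exact natDegree_sum_le_of_forall_le _ _ fun v hv =>
      (natDegree_C_mul_le _ _).trans ((hprod v _).1.trans (hdeg v hv))
  · rw [finsetSum_coeff, homogeneousComponent_apply, map_sum, map_sum, Finset.sum_filter]
    refine Finset.sum_congr rfl fun v hv => ?_
    rw [coeff_C_mul, Finsupp.degree_eq_sum]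
    split_ifs with h
    · rw [← h, (hprod v _).2, MvPolynomial.eval_monomial, Finsupp.prod_fintype _ _ (by simp)]
      simp
    · rw [coeff_eq_zero_of_natDegree_lt ((hprod v _).1.trans_lt (lt_of_le_of_ne (hdeg v hv) h)),
        mul_zero]

open MvPolynomial in
theorem MvPolynomial.homogeneousComponent_totalDegree_ne_zero {σ R : Type*} [CommSemiring R]
    {F : MvPolynomial σ R} (h : F ≠ 0) : homogeneousComponent F.totalDegree F ≠ 0 := by
  obtain ⟨m, hm, hmd⟩ := Finset.exists_mem_eq_sup _ (support_nonempty.mpr h)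
    (fun s : σ →₀ ℕ => s.sum fun _ e => e)
  intro h0
  have h1 := coeff_homogeneousComponent F.totalDegree F m
  have h2 : m.degree = F.totalDegree := hmd.symm
  rw [h0, if_pos h2, coeff_zero] at h1
  exact mem_support_iff.mp hm h1.symm

open MvPolynomial in
/-- Elimination of one variable by a generic linear substitution `x j = y j + c j z`, with `c` such
that the leading form of the relation `F` does not vanish at `c` (so that `z` is integral over the
`y j`) and the derivative of `F` in the direction `c` does not vanish at `x` (so that `z` is a simple
root). -/
theorem exists_linear_elimination {k K : Type*} [Field k] [Infinite k] [Field K] [Algebra k K]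
    {n : ℕ} {x : Fin (n + 1) → K} {F : MvPolynomial (Fin (n + 1)) k} (hF : F ≠ 0)
    (hFx : aeval x F = 0) {i : Fin (n + 1)} (hi : aeval x (pderiv i F) ≠ 0) :
    ∃ (y : Fin n → K) (z : K), (∀ j, y j ∈ Algebra.adjoin k (Set.range x)) ∧
      (∀ j, x j ∈ Algebra.adjoin k (insert z (Set.range y))) ∧
      IsIntegral (Algebra.adjoin k (Set.range y)) z ∧
      ∃ G : Polynomial (Algebra.adjoin k (Set.range y)),
        Polynomial.aeval z G = 0 ∧ Polynomial.aeval z G.derivative ≠ 0 := by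
  classical
  obtain ⟨c, hc0, hc1, hc2⟩ : ∃ c : Fin (n + 1) → k,
      eval c (homogeneousComponent F.totalDegree F) ≠ 0 ∧
      ∑ j, aeval x (pderiv j F) * algebraMap k K (c j) ≠ 0 ∧ c 0 ≠ 0 := by
    -- a nonzero polynomial over `K` does not vanish on all points with coordinates in `k`
    set H : MvPolynomial (Fin (n + 1)) K :=
      map (algebraMap k K) (homogeneousComponent F.totalDegree F) *
        (∑ j, C (aeval x (pderiv j F)) * X j) * X 0 with hH
    have h0 : H ≠ 0 := by
      refine mul_ne_zero (mul_ne_zero ?_ ?_) (X_ne_zero _)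
      · rw [Ne, map_eq_zero_iff _ (map_injective _ (algebraMap k K).injective)]
        exact homogeneousComponent_totalDegree_ne_zero hF
      · intro h
        have h1 := congrArg (coeff (Finsupp.single i 1)) h
        rw [coeff_sum, coeff_zero, Finset.sum_eq_single i] at h1
        · rw [coeff_C_mul, coeff_X, if_pos rfl, mul_one] at h1
          exact hi h1
        · intro j _ hj
          rw [coeff_C_mul, coeff_X, if_neg, mul_zero]
          rw [Finsupp.single_left_inj one_ne_zero]
          exact hj
        · simp
    by_contra! hcon
    refine h0 (funext_set (fun _ => Set.range (algebraMap k K))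
      (fun _ => Set.infinite_range_of_injective (algebraMap k K).injective) fun w hw => ?_)
    choose c hc using fun j => hw j (Set.mem_univ j)
    obtain rfl : (fun j => algebraMap k K (c j)) = w := _root_.funext hc
    have h1 := hcon c
    rw [map_zero, hH, map_mul, map_mul, map_sum, eval_X]
    simp only [map_mul, eval_C, eval_X]
    have h2 : eval (fun j => algebraMap k K (c j))
        (map (algebraMap k K) (homogeneousComponent F.totalDegree F)) =
        algebraMap k K (eval c (homogeneousComponent F.totalDegree F)) := by
      exact (eval_map _ _ _).trans (map_eval₂Hom (RingHom.id k) c (algebraMap k K) _).symm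
    rw [h2]
    by_cases h3 : eval c (homogeneousComponent F.totalDegree F) = 0
    · simp [h3]
    · by_cases h4 : ∑ j, aeval x (pderiv j F) * algebraMap k K (c j) = 0
      · simp [h4]
      · simp [h1 h3 h4]
  set z : K := x 0 / algebraMap k K (c 0) with hz
  set y : Fin n → K := fun j => x j.succ - algebraMap k K (c j.succ) * z with hy
  have hc0' : algebraMap k K (c 0) ≠ 0 := by simpa using hc2
  have hzx : z ∈ Algebra.adjoin k (Set.range x) := by
    have : z = (c 0)⁻¹ • x 0 := by rw [hz, Algebra.smul_def, map_inv₀]; field_simp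
    rw [this]
    exact Subalgebra.smul_mem _ (Algebra.subset_adjoin (Set.mem_range_self _)) _
  set R₀ := Algebra.adjoin k (Set.range y) with hR₀
  set a : Fin (n + 1) → R₀ :=
    Fin.cons (α := fun _ => R₀) 0 fun j =>
      (⟨y j, Algebra.subset_adjoin (Set.mem_range_self j)⟩ : R₀) with ha
  have hax : ∀ j, (a j : K) + algebraMap k K (c j) * z = x j := by
    intro j
    refine Fin.cases ?_ (fun j => ?_) j
    · simp only [ha, Fin.cons_zero, ZeroMemClass.coe_zero, zero_add, hz]; field_simp
    · simp [ha, hy]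
  set l : Fin (n + 1) → Polynomial R₀ :=
    fun j => Polynomial.C (a j) + Polynomial.C (algebraMap k R₀ (c j)) * Polynomial.X with hl
  have hlx : ∀ P : MvPolynomial (Fin (n + 1)) k,
      Polynomial.aeval z (aeval l P) = aeval x P := by
    intro P
    have : ((Polynomial.aeval (R := R₀) z).restrictScalars k).comp (aeval l) = aeval x := by
      refine MvPolynomial.algHom_ext fun j => ?_
      simp only [AlgHom.comp_apply, aeval_X, AlgHom.restrictScalars_apply]
      rw [← hax j, hl]
      simp only [map_add, map_mul, Polynomial.aeval_C, Polynomial.aeval_X]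
      rfl
    exact DFunLike.congr_fun this P
  obtain ⟨hdeg, hlead⟩ := Polynomial.natDegree_aeval_linear_le a c F
  rw [← hl] at hdeg hlead
  refine ⟨y, z, fun j => ?_, fun j => ?_, ?_, aeval l F, ?_, ?_⟩
  · exact Subalgebra.sub_mem _ (Algebra.subset_adjoin (Set.mem_range_self _))
      (by rw [← Algebra.smul_def]; exact Subalgebra.smul_mem _ hzx _)
  · rw [← hax j]
    refine Subalgebra.add_mem _ (Algebra.adjoin_mono (Set.subset_insert _ _) (a j).2) ?_
    rw [← Algebra.smul_def]
    exact Subalgebra.smul_mem _ (Algebra.subset_adjoin (Set.mem_insert _ _)) _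
  · refine ⟨Polynomial.C (algebraMap k R₀ (eval c (homogeneousComponent F.totalDegree F))⁻¹) *
      aeval l F, ?_, ?_⟩
    · refine Polynomial.monic_of_natDegree_le_of_coeff_eq_one F.totalDegree
        ((Polynomial.natDegree_C_mul_le _ _).trans hdeg) ?_
      rw [Polynomial.coeff_C_mul, hlead, ← map_mul, inv_mul_cancel₀ hc0, map_one]
    · rw [← Polynomial.aeval_def, map_mul, hlx, hFx, mul_zero]
  · rw [hlx, hFx]
  · rw [Polynomial.derivative_mvPolynomial_aeval, map_sum]
    convert! hc1 using 1
    refine Finset.sum_congr rfl fun j _ => ?_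
    rw [map_mul, hlx, hl]
    simp

theorem isSeparable_of_aeval_derivative_ne_zero {F E : Type*} [Field F] [Field E] [Algebra F E]
    {z : E} {G : Polynomial F} (h : Polynomial.aeval z G = 0)
    (h' : Polynomial.aeval z G.derivative ≠ 0) : IsSeparable F z := by
  have hG : G ≠ 0 := by rintro rfl; simp at h'
  have hint : IsIntegral F z := isAlgebraic_iff_isIntegral.mp ⟨G, hG, h⟩
  refine (Polynomial.separable_iff_derivative_ne_zero (minpoly.irreducible hint)).mpr fun h0 => ?_
  obtain ⟨Q, rfl⟩ := minpoly.dvd F z h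
  apply h'
  rw [Polynomial.derivative_mul, h0]
  simp

/-- Separable Noether normalization: finitely many elements of a field extension of a perfect infinite
field are integral, and separable, over algebraically independent elements of the algebra they
generate. -/
theorem exists_algebraicIndependent_isIntegral_isSeparable {k K : Type*} [Field k] [PerfectField k]
    [Infinite k] [Field K] [Algebra k K] {n : ℕ} (x : Fin n → K) :
    ∃ (m : ℕ) (y : Fin m → K), AlgebraicIndependent k y ∧
      (∀ j, y j ∈ Algebra.adjoin k (Set.range x)) ∧
      (∀ j, IsIntegral (Algebra.adjoin k (Set.range y)) (x j)) ∧
      ∀ j, IsSeparable (IntermediateField.adjoin k (Set.range y)) (x j) := by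
  induction n with
  | zero =>
    exact ⟨0, x, by rw [algebraicIndependent_empty_type_iff]; exact (algebraMap k K).injective,
      fun j => j.elim0, fun j => j.elim0, fun j => j.elim0⟩
  | succ n ih =>
    by_cases hx : AlgebraicIndependent k x
    · exact ⟨n + 1, x, hx, fun j => Algebra.subset_adjoin ⟨j, rfl⟩,
        fun j => isIntegral_algebraMap (R := Algebra.adjoin k (Set.range x))
          (x := ⟨x j, Algebra.subset_adjoin ⟨j, rfl⟩⟩),
        fun j => isSeparable_algebraMap (F := IntermediateField.adjoin k (Set.range x))
          ⟨x j, IntermediateField.subset_adjoin _ _ ⟨j, rfl⟩⟩⟩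
    · obtain ⟨F, hF0, hFx, i, hi⟩ := exists_relation_aeval_pderiv_ne_zero hx
      obtain ⟨y, z, hyx, hxy, hzint, G, hG, hG'⟩ := exists_linear_elimination hF0 hFx hi
      obtain ⟨m, w, hw, hwy, hint, hsep⟩ := ih y
      have hS : Algebra.adjoin k (insert z (Set.range y)) ≤
          (integralClosure (Algebra.adjoin k (Set.range w)) K).restrictScalars k := by
        have h1 : Algebra.adjoin k (Set.range y) ≤
            (integralClosure (Algebra.adjoin k (Set.range w)) K).restrictScalars k :=
          Algebra.adjoin_le (by rintro _ ⟨j, rfl⟩; exact hint j)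
        refine Algebra.adjoin_le (Set.insert_subset ?_ (Algebra.subset_adjoin.trans h1))
        have h2 : IsIntegral (integralClosure (Algebra.adjoin k (Set.range w)) K) z :=
          hzint.map_of_comp_eq (Subalgebra.inclusion h1).toRingHom (RingHom.id K) rfl
        exact isIntegral_trans z h2
      have hT : Algebra.adjoin k (insert z (Set.range y)) ≤
          ((separableClosure (IntermediateField.adjoin k (Set.range w)) K).restrictScalars
            k).toSubalgebra := by
        have h1 : Algebra.adjoin k (Set.range y) ≤
            ((separableClosure (IntermediateField.adjoin k (Set.range w)) K).restrictScalars
              k).toSubalgebra :=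
          Algebra.adjoin_le (by rintro _ ⟨j, rfl⟩; exact hsep j)
        refine Algebra.adjoin_le (Set.insert_subset ?_ (Algebra.subset_adjoin.trans h1))
        let φ : Algebra.adjoin k (Set.range y) →+*
            separableClosure (IntermediateField.adjoin k (Set.range w)) K :=
          (Subalgebra.inclusion h1).toRingHom
        have hφ : ∀ Q, Polynomial.aeval z (Polynomial.map φ Q) = Polynomial.aeval z Q := by
          intro Q
          rw [Polynomial.aeval_def, Polynomial.eval₂_map]
          rfl
        have h2 : IsSeparable (separableClosure (IntermediateField.adjoin k (Set.range w)) K) z :=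
          isSeparable_of_aeval_derivative_ne_zero (G := G.map φ) (by rw [hφ, hG])
            (by rwa [Polynomial.derivative_map, hφ])
        exact IsSeparable.of_algebra_isSeparable_of_isSeparable _ h2
      refine ⟨m, w, hw, fun j => ?_, fun j => hS (hxy j), fun j => hT (hxy j)⟩
      exact (Algebra.adjoin_le (by rintro _ ⟨j, rfl⟩; exact hyx j) :
        Algebra.adjoin k (Set.range y) ≤ _) (hwy j)

/-! ### Finiteness of the integral closure -/

theorem finite_of_essFiniteType_of_isAlgebraic (F K : Type*) [Field F] [Field K] [Algebra F K]
    [Algebra.EssFiniteType F K] [Algebra.IsAlgebraic F K] : Module.Finite F K := by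
  obtain ⟨s, hs⟩ := IntermediateField.fg_top F K
  have h : FiniteDimensional F (IntermediateField.adjoin F (s : Set K)) :=
    IntermediateField.finiteDimensional_adjoin fun w _ => Algebra.IsIntegral.isIntegral w
  rw [hs] at h
  exact Module.Finite.equiv (IntermediateField.topEquiv (F := F) (E := K)).toLinearEquiv

open scoped IntermediateField.algebraAdjoinAdjoin in
/-- A finitely generated domain over a perfect infinite field has a finite integral closure in its
fraction field `K`: a normalization makes `K` finite separable over the fraction field of a polynomial
ring inside `R`, where the trace form applies. -/
theorem finite_integralClosure_fractionField (k R K : Type*) [Field k] [PerfectField k]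
    [Infinite k] [CommRing R] [Algebra k R] [Algebra.FiniteType k R] [Field K] [Algebra R K]
    [IsFractionRing R K] : Module.Finite R (integralClosure R K) := by
  classical
  have : IsDomain R := (IsFractionRing.injective R K).isDomain (algebraMap R K)
  let _ : Algebra k K := ((algebraMap R K).comp (algebraMap k R)).toAlgebra
  have : IsScalarTower k R K := .of_algebraMap_eq fun _ => rfl
  have : IsNoetherianRing R := Algebra.FiniteType.isNoetherianRing k R
  obtain ⟨s, hs⟩ := Algebra.FiniteType.out (R := k) (A := R)
  obtain ⟨n, x, hx⟩ : ∃ (n : ℕ) (x : Fin n → R), Set.range x = s := by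
    exact ⟨s.card, fun i => s.equivFin.symm i, by
      rw [Set.range_comp' Subtype.val, Set.range_eq_univ.mpr (Equiv.surjective _)]; simp⟩
  have hadj : Algebra.adjoin k (Set.range fun i => algebraMap R K (x i)) =
      (IsScalarTower.toAlgHom k R K).range := by
    rw [Set.range_comp' (algebraMap R K), hx, ← Algebra.map_top, ← hs]
    exact (AlgHom.map_adjoin (IsScalarTower.toAlgHom k R K) _).symm
  obtain ⟨m, y, hy, hyx, hint, hsep⟩ :=
    exists_algebraicIndependent_isIntegral_isSeparable (k := k) fun i => algebraMap R K (x i)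
  set P := Algebra.adjoin k (Set.range y) with hP
  set F := IntermediateField.adjoin k (Set.range y) with hF
  -- the polynomial ring `P` lies in the image of `R`, which is integral over it
  have hPR : ∀ p : P, ∃ r : R, algebraMap R K r = p := fun p => by
    have h1 : P ≤ Algebra.adjoin k (Set.range fun i => algebraMap R K (x i)) :=
      Algebra.adjoin_le (by rintro _ ⟨j, rfl⟩; exact hyx j)
    have h2 := h1 p.2
    rw [hadj] at h2
    exact h2
  have hRint : ∀ r : R, IsIntegral P (algebraMap R K r) := by
    have h1 : Algebra.adjoin k (Set.range fun i => algebraMap R K (x i)) ≤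
        (integralClosure P K).restrictScalars k :=
      Algebra.adjoin_le (by rintro _ ⟨j, rfl⟩; exact hint j)
    intro r
    have h2 : algebraMap R K r ∈ (IsScalarTower.toAlgHom k R K).range := ⟨r, rfl⟩
    rw [← hadj] at h2
    exact h1 h2
  have hRsep : ∀ r : R, algebraMap R K r ∈ separableClosure F K := by
    have h1 : Algebra.adjoin k (Set.range fun i => algebraMap R K (x i)) ≤
        ((separableClosure F K).restrictScalars k).toSubalgebra :=
      Algebra.adjoin_le (by rintro _ ⟨j, rfl⟩; exact hsep j)
    intro r
    have h2 : algebraMap R K r ∈ (IsScalarTower.toAlgHom k R K).range := ⟨r, rfl⟩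
    rw [← hadj] at h2
    exact h1 h2
  have hKsep : Algebra.IsSeparable F K := by
    rw [← separableClosure.eq_top_iff, eq_top_iff]
    rintro w -
    obtain ⟨a, b, hb, rfl⟩ := IsFractionRing.div_surjective R w
    exact div_mem (hRsep a) (hRsep b)
  have : Algebra.EssFiniteType R K := Algebra.EssFiniteType.of_isLocalization K (nonZeroDivisors R)
  have : Algebra.EssFiniteType k K := Algebra.EssFiniteType.comp k R K
  have : Algebra.EssFiniteType F K := Algebra.EssFiniteType.of_comp k F K
  have hKfin : Module.Finite F K := finite_of_essFiniteType_of_isAlgebraic F K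
  have hPnoeth : IsNoetherianRing P :=
    isNoetherianRing_of_ringEquiv (MvPolynomial (Fin m) k) hy.aevalEquiv.toRingEquiv
  have hPufd : UniqueFactorizationMonoid P :=
    (hy.aevalEquiv.toMulEquiv).uniqueFactorizationMonoid inferInstance
  have hPint : IsIntegrallyClosed P := inferInstance
  let _ : Algebra P F := inferInstanceAs
    (Algebra (Algebra.adjoin k (Set.range y)) (IntermediateField.adjoin k (Set.range y)))
  have hfrac : IsFractionRing P F := inferInstanceAs (IsFractionRing
    (Algebra.adjoin k (Set.range y)) (IntermediateField.adjoin k (Set.range y)))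
  have : IsScalarTower P F K := .of_algebraMap_eq fun _ => rfl
  have hfin : Module.Finite P (integralClosure P K) :=
    IsIntegralClosure.finite P F K (integralClosure P K)
  obtain ⟨S, hS⟩ := hfin
  set N : Submodule R K := Submodule.span R (Subtype.val '' (S : Set (integralClosure P K)))
    with hN
  have hNfg : N.FG := Submodule.fg_span (S.finite_toSet.image _)
  have hle : Subalgebra.toSubmodule (integralClosure R K) ≤ N := by
    intro w hw
    have hw' : IsIntegral P w := by
      have h1 : (IsScalarTower.toAlgHom k R K).range ≤ (integralClosure P K).restrictScalars k := by
        rintro _ ⟨r, rfl⟩; exact hRint r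
      have h2 : IsIntegral (integralClosure P K) w :=
        IsIntegral.map_of_comp_eq ((Subalgebra.inclusion h1).toRingHom.comp
          (IsScalarTower.toAlgHom k R K).rangeRestrict.toRingHom) (RingHom.id K) rfl hw
      exact isIntegral_trans w h2
    have h1 : (⟨w, hw'⟩ : integralClosure P K) ∈ Submodule.span P (S : Set _) := by
      rw [hS]; trivial
    have h2 : ∀ v : integralClosure P K, v ∈ Submodule.span P (S : Set _) → (v : K) ∈ N := by
      intro v hv
      induction hv using Submodule.span_induction with
      | mem v hv => exact Submodule.subset_span ⟨v, hv, rfl⟩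
      | zero => exact N.zero_mem
      | add a b _ _ ha hb => exact N.add_mem ha hb
      | smul p v _ hv =>
        obtain ⟨r, hr⟩ := hPR p
        have : ((p • v : integralClosure P K) : K) = r • (v : K) := by
          rw [Algebra.smul_def, Algebra.smul_def, hr]; rfl
        rw [this]
        exact N.smul_mem _ hv
    exact h2 _ h1
  have : IsNoetherian R N := isNoetherian_of_fg_of_noetherian N hNfg
  exact Module.Finite.of_injective (Submodule.inclusion hle) (Submodule.inclusion_injective hle)

/-- Finiteness of the integral closure of `R` in a domain `D` that is obtained from the image of `R` by
inverting `t`. The map `R → D` need not be injective. -/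
theorem finite_integralClosure_of_isUnit (k : Type*) {R D : Type*} [Field k] [PerfectField k]
    [Infinite k] [CommRing R] [Algebra k R] [Algebra.FiniteType k R] [CommRing D] [IsDomain D]
    [Algebra R D] {t : R} (htu : IsUnit (algebraMap R D t))
    (hD : ∀ x : D, ∃ (n : ℕ) (r : R), algebraMap R D (t ^ n) * x = algebraMap R D r) :
    Module.Finite R (integralClosure R D) := by
  let _ : Algebra k D := ((algebraMap R D).comp (algebraMap k R)).toAlgebra
  have : IsScalarTower k R D := .of_algebraMap_eq fun _ => rfl
  have : IsNoetherianRing R := Algebra.FiniteType.isNoetherianRing k R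
  set R' : Subalgebra R D := ⊥ with hR'
  have hR'mem : ∀ r : R, algebraMap R D r ∈ R' := fun r => R'.algebraMap_mem r
  have : Algebra.FiniteType k R' :=
    Algebra.FiniteType.of_surjective (IsScalarTower.toAlgHom k R R') (by
      rintro ⟨x, hx⟩
      obtain ⟨r, rfl⟩ := Algebra.mem_bot.mp hx
      exact ⟨r, rfl⟩)
  set K := FractionRing D
  have hinj : Function.Injective (algebraMap D K) := IsFractionRing.injective D K
  have : FaithfulSMul R' K := (faithfulSMul_iff_algebraMap_injective R' K).mpr
    (hinj.comp Subtype.val_injective)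
  have : IsFractionRing R' K := by
    refine IsFractionRing.of_field R' K fun z => ?_
    obtain ⟨x, y, hy, rfl⟩ := IsFractionRing.div_surjective D z
    obtain ⟨n, r, hr⟩ := hD x
    obtain ⟨m, s, hs⟩ := hD y
    have hy0 : algebraMap D K y ≠ 0 := by simpa using hy
    have ht : ∀ i, algebraMap D K (algebraMap R D (t ^ i)) ≠ 0 := fun i => by
      rw [map_pow, map_pow]
      exact pow_ne_zero _ ((map_ne_zero_iff _ hinj).mpr htu.ne_zero)
    refine ⟨⟨_, hR'mem (t ^ m * r)⟩, ⟨_, hR'mem (t ^ n * s)⟩, ?_⟩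
    change _ = algebraMap D K (algebraMap R D (t ^ m * r)) /
      algebraMap D K (algebraMap R D (t ^ n * s))
    rw [map_mul (algebraMap R D), map_mul (algebraMap R D), ← hr, ← hs]
    simp only [map_mul (algebraMap D K)]
    rw [div_eq_div_iff hy0 (mul_ne_zero (ht n) (mul_ne_zero (ht m) hy0))]
    ring
  have hfin := finite_integralClosure_fractionField k R' K
  have : Module.Finite R R' := Module.Finite.of_surjective (Algebra.linearMap R R') (by
      rintro ⟨x, hx⟩
      obtain ⟨r, rfl⟩ := Algebra.mem_bot.mp hx
      exact ⟨r, rfl⟩)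
  have : IsScalarTower R R' (integralClosure R' K) := .of_algebraMap_eq fun _ => rfl
  have : Module.Finite R (integralClosure R' K) := Module.Finite.trans R' _
  let f : integralClosure R D →ₗ[R] integralClosure R' K :=
    { toFun x := ⟨algebraMap D K x, x.2.map_of_comp_eq (algebraMap R R') (algebraMap D K) rfl⟩
      map_add' x y := Subtype.ext (map_add _ _ _)
      map_smul' r x := Subtype.ext (by
        simp only [Algebra.smul_def, RingHom.id_apply]
        exact map_mul (algebraMap D K) _ _) }
  refine Module.Finite.of_injective f fun x y hxy => Subtype.ext (hinj (congrArg Subtype.val hxy))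

/-! ### Rees valuations of a principal ideal -/

/-- Let `C` be a Noetherian domain that is integrally closed in a domain `D`, and let `t : C` become
a unit in `D`. Then the localization of `C` at an associated prime `Q = (t : b)` of `t` is a
discrete valuation ring. -/
theorem isDiscreteValuationRing_localization_of_eq_colon {C D : Type*} [CommRing C] [IsDomain C]
    [IsNoetherianRing C] [CommRing D] [IsDomain D] [Algebra C D] [FaithfulSMul C D]
    (hclosed : ∀ x : D, IsIntegral C x → x ∈ (algebraMap C D).range) {t b : C} (ht : t ≠ 0)
    (htu : IsUnit (algebraMap C D t)) (Q : Ideal C) [hQ : Q.IsPrime]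
    (hQb : ∀ c, c ∈ Q ↔ t ∣ c * b) :
    IsDiscreteValuationRing (Localization.AtPrime Q) := by
  have hinj : Function.Injective (algebraMap C D) := FaithfulSMul.algebraMap_injective C D
  have htQ : t ∈ Q := (hQb t).mpr (dvd_mul_right _ _)
  have hb : ¬ t ∣ b := fun h => hQ.ne_top (Q.eq_top_iff_one.mpr ((hQb 1).mpr (by simpa using h)))
  -- otherwise `b / t` would map `Q` into itself and be integral
  obtain ⟨q, hq, u, hu, hqb⟩ : ∃ q ∈ Q, ∃ u, u ∉ Q ∧ q * b = t * u := by
    by_contra! hcon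
    obtain ⟨τ, hτ⟩ := htu.exists_right_inv
    have hint : IsIntegral C (algebraMap C D b * τ) := by
      refine isIntegral_of_smul_mem_submodule (M := D) (Submodule.map (Algebra.linearMap C D) Q)
        ?_ ((IsNoetherian.noetherian Q).map _) _ ?_
      · rw [Submodule.ne_bot_iff]
        exact ⟨algebraMap C D t, ⟨t, htQ, rfl⟩, by simpa using (map_ne_zero_iff _ hinj).mpr ht⟩
      · rintro _ ⟨q, hq, rfl⟩
        obtain ⟨u, hu⟩ := (hQb q).mp hq
        refine ⟨u, by_contra fun h => hcon q hq u h hu, ?_⟩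
        have h1 := congrArg (algebraMap C D) hu
        rw [map_mul, map_mul] at h1
        simp only [Algebra.linearMap_apply, smul_eq_mul]
        linear_combination (-τ) * h1 + (- algebraMap C D u) * hτ
    obtain ⟨c, hc⟩ := hclosed _ hint
    refine hb ⟨c, hinj ?_⟩
    rw [map_mul, hc]
    linear_combination (-algebraMap C D b) * hτ
  have hmax : IsLocalRing.maximalIdeal (Localization.AtPrime Q) =
      Ideal.span {algebraMap C (Localization.AtPrime Q) q} := by
    rw [← Localization.AtPrime.map_eq_maximalIdeal]
    refine le_antisymm (Ideal.map_le_iff_le_comap.mpr fun q' hq' => ?_) ?_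
    · obtain ⟨u', hu'⟩ := (hQb q').mp hq'
      have h1 : q' * u = q * u' := by
        refine mul_left_cancel₀ ht ?_
        linear_combination (-q') * hqb + q * hu'
      rw [Ideal.mem_comap, Ideal.mem_span_singleton]
      have h2 : IsUnit (algebraMap C (Localization.AtPrime Q) u) :=
        (IsLocalization.AtPrime.isUnit_to_map_iff _ Q u).mpr hu
      refine (IsUnit.dvd_mul_right h2).mp ?_
      rw [← map_mul, h1, map_mul]
      exact dvd_mul_right _ _
    · rw [Ideal.span_singleton_le_iff_mem]
      exact Ideal.mem_map_of_mem _ hq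
  have hnf : ¬ IsField (Localization.AtPrime Q) := by
    rw [IsLocalRing.isField_iff_maximalIdeal_eq, ← Localization.AtPrime.map_eq_maximalIdeal]
    intro h
    have h1 := Ideal.mem_map_of_mem (algebraMap C (Localization.AtPrime Q)) htQ
    rw [h, Ideal.mem_bot] at h1
    exact ht ((map_eq_zero_iff _ (IsLocalization.injective _ Q.primeCompl_le_nonZeroDivisors)).mp h1)
  have hiff : IsDiscreteValuationRing (Localization.AtPrime Q) ↔
      (IsLocalRing.maximalIdeal (Localization.AtPrime Q)).IsPrincipal :=
    (IsDiscreteValuationRing.TFAE (Localization.AtPrime Q) hnf).out 0 4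
  exact hiff.mpr ⟨⟨_, hmax⟩⟩

open WithZero in
/-- The valuation on `C` given by a prime `Q` at which the localization is a discrete valuation
ring. The last clause says that an inequality of values is a divisibility in `C_Q`. -/
theorem exists_valuation_of_isDiscreteValuationRing {C : Type*} [CommRing C] [IsDomain C]
    (Q : Ideal C) [Q.IsPrime] [IsDiscreteValuationRing (Localization.AtPrime Q)] :
    ∃ v : Valuation C ℤᵐ⁰, (∀ c, v c ≤ 1) ∧ (∀ c, v c = 0 ↔ c = 0) ∧ (∀ c, v c < 1 ↔ c ∈ Q) ∧
      ∀ b t, t ≠ 0 → v b ≤ v t → ∃ u, u ∉ Q ∧ t ∣ u * b := by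
  set L := Localization.AtPrime Q
  have hinj : Function.Injective (algebraMap C L) :=
    IsLocalization.injective _ Q.primeCompl_le_nonZeroDivisors
  set w := (IsDiscreteValuationRing.maximalIdeal L).intValuation with hw
  have hw0 : ∀ x : L, w x = 0 ↔ x = 0 := fun x =>
    ⟨fun h => by_contra fun hx =>
      IsDedekindDomain.HeightOneSpectrum.intValuation_ne_zero _ x hx h, fun h => by simp [h]⟩
  have hw1 : ∀ x : L, w x < 1 ↔ x ∈ IsLocalRing.maximalIdeal L := fun x =>
    IsDedekindDomain.HeightOneSpectrum.intValuation_lt_one_iff_mem _ x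
  have hle : ∀ x : L, w x ≤ 1 := IsDedekindDomain.HeightOneSpectrum.intValuation_le_one _
  refine ⟨w.comap (algebraMap C L), fun c => hle _, fun c => ?_, fun c => ?_, fun b t ht h => ?_⟩
  · rw [Valuation.comap_apply, hw0, map_eq_zero_iff _ hinj]
  · rw [Valuation.comap_apply, hw1, IsLocalization.AtPrime.to_map_mem_maximal_iff L Q]
  · rw [Valuation.comap_apply, Valuation.comap_apply] at h
    have hdvd : algebraMap C L t ∣ algebraMap C L b := by
      rcases ValuationRing.dvd_total (algebraMap C L t) (algebraMap C L b) with h1 | ⟨y, hy⟩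
      · exact h1
      · have h2 : w y = 1 := by
          have h3 : w (algebraMap C L b) ≠ 0 := by
            intro h0
            rw [hw0] at h0
            rw [h0, zero_mul, map_eq_zero_iff _ hinj] at hy
            exact ht hy
          refine le_antisymm (hle y) ?_
          rw [hy, map_mul] at h
          exact le_of_mul_le_mul_left (by simpa using h) (zero_lt_iff.mpr h3)
        have h4 : IsUnit y := by
          by_contra h5
          have := (hw1 y).mpr ((IsLocalRing.mem_maximalIdeal y).mpr h5)
          exact this.ne h2
        rw [hy]
        exact h4.mul_right_dvd.mpr dvd_rfl
    obtain ⟨z, hz⟩ := hdvd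
    obtain ⟨⟨a, s⟩, hs⟩ := IsLocalization.surj Q.primeCompl z
    refine ⟨s, s.2, a, hinj ?_⟩
    dsimp only at hs
    rw [map_mul, map_mul, hz, ← hs]
    ring

open WithZero in
/-- Rees valuations of a principal ideal: if the Noetherian domain `C` is integrally closed in `D`
and `t` becomes a unit in `D`, then divisibility by the powers of `t` is tested by finitely many
discrete valuations that are positive at `t`. -/
theorem exists_finite_valuations_pow_dvd {C D : Type*} [CommRing C] [IsDomain C]
    [IsNoetherianRing C] [CommRing D] [IsDomain D] [Algebra C D] [FaithfulSMul C D]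
    (hclosed : ∀ x : D, IsIntegral C x → x ∈ (algebraMap C D).range) {t : C} (ht : t ≠ 0)
    (htu : IsUnit (algebraMap C D t)) :
    ∃ s : Set (Valuation C ℤᵐ⁰), s.Finite ∧
      (∀ v ∈ s, (∀ c, v c ≤ 1) ∧ (∀ c, v c = 0 ↔ c = 0) ∧ v t < 1) ∧
      ∀ (b : C) (m : ℕ), (∀ v ∈ s, v b ≤ v (t ^ m)) → t ^ m ∣ b := by
  have hass : ∀ Q ∈ associatedPrimes C (C ⧸ Ideal.span {t}), Q.IsPrime ∧
      ∃ b, ∀ c, c ∈ Q ↔ t ∣ c * b := by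
    intro Q hQ
    obtain ⟨h1, x, hx⟩ := Submodule.isAssociatedPrime_iff.mp hQ
    obtain ⟨b, rfl⟩ := Ideal.Quotient.mk_surjective x
    refine ⟨h1, b, fun c => ?_⟩
    rw [hx, Submodule.mem_colon_singleton, Submodule.mem_bot, ← Ideal.mem_span_singleton,
      ← Ideal.Quotient.eq_zero_iff_mem, map_mul]
    rfl
  have hex : ∀ Q : associatedPrimes C (C ⧸ Ideal.span {t}),
      ∃ v : Valuation C ℤᵐ⁰, (∀ c, v c ≤ 1) ∧ (∀ c, v c = 0 ↔ c = 0) ∧ (∀ c, v c < 1 ↔ c ∈ Q.1) ∧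
      ∀ b t, t ≠ 0 → v b ≤ v t → ∃ u, u ∉ Q.1 ∧ t ∣ u * b := by
    rintro ⟨Q, hQ⟩
    obtain ⟨h1, b, hb⟩ := hass Q hQ
    have := isDiscreteValuationRing_localization_of_eq_colon hclosed ht htu Q hb
    exact exists_valuation_of_isDiscreteValuationRing Q
  choose v hv using hex
  refine ⟨Set.range v, @Set.finite_range _ _ v (associatedPrimes.finite C (C ⧸ Ideal.span {t})),
    ?_, fun b m h => ?_⟩
  · rintro _ ⟨⟨Q, hQ⟩, rfl⟩
    obtain ⟨-, a, ha⟩ := hass Q hQ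
    exact ⟨(hv ⟨Q, hQ⟩).1, (hv ⟨Q, hQ⟩).2.1,
      ((hv ⟨Q, hQ⟩).2.2.1 t).mpr ((ha t).mpr (dvd_mul_right _ _))⟩
  · -- if `t` did not divide `b`, an associated prime `Q` of `t` would contain all `u` with `t ∣ u b`
    induction m generalizing b with
    | zero => simp
    | succ m ih =>
      have hb : t ∣ b := by
        by_contra hb
        have hb' : (Ideal.Quotient.mk (Ideal.span {t}) b) ≠ 0 := by
          rwa [Ne, Ideal.Quotient.eq_zero_iff_mem, Ideal.mem_span_singleton]
        obtain ⟨Q, hQ, hle⟩ := exists_le_isAssociatedPrime_of_isNoetherianRing C _ hb'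
        have h1 : v ⟨Q, hQ⟩ b ≤ v ⟨Q, hQ⟩ t := by
          refine (h _ ⟨⟨Q, hQ⟩, rfl⟩).trans ?_
          rw [pow_succ, map_mul]
          exact mul_le_of_le_one_left' ((hv ⟨Q, hQ⟩).1 _)
        obtain ⟨u, hu, hd⟩ := (hv ⟨Q, hQ⟩).2.2.2 b t ht h1
        refine hu (hle ?_)
        rw [Submodule.mem_colon_singleton, Submodule.mem_bot]
        rw [← Ideal.mem_span_singleton, ← Ideal.Quotient.eq_zero_iff_mem, map_mul] at hd
        exact hd
      obtain ⟨b', rfl⟩ := hb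
      rw [pow_succ']
      refine mul_dvd_mul_left t (ih b' ?_)
      rintro _ ⟨Q, rfl⟩
      have h1 := h _ ⟨Q, rfl⟩
      rw [pow_succ', map_mul, map_mul] at h1
      refine le_of_mul_le_mul_left h1 (zero_lt_iff.mpr ?_)
      rw [Ne, (hv Q).2.1]
      exact ht

noncomputable section

/-! ### Integrality tested by finitely many valuations -/

open WithZero in
/-- Integrality over a finitely generated algebra `R` of an element of a domain `D`, obtained from
the image of `R` by inverting `t`, is tested by finitely many discrete valuations. -/
theorem exists_finite_valuations_isIntegral_iff (k : Type*) {R D : Type*} [Field k]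
    [PerfectField k] [Infinite k] [CommRing R] [Algebra k R] [Algebra.FiniteType k R] [CommRing D]
    [IsDomain D] [Algebra R D] {t : R} (htu : IsUnit (algebraMap R D t))
    (hD : ∀ x : D, ∃ (n : ℕ) (r : R), algebraMap R D (t ^ n) * x = algebraMap R D r) :
    ∃ s : Set (Valuation D ℤᵐ⁰), s.Finite ∧
      (∀ v ∈ s, (∀ r, v (algebraMap R D r) ≤ 1) ∧ (∀ x, v x = 0 ↔ x = 0) ∧
        v (algebraMap R D t) < 1) ∧
      ∀ x, IsIntegral R x ↔ ∀ v ∈ s, v x ≤ 1 := by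
  have : IsNoetherianRing R := Algebra.FiniteType.isNoetherianRing k R
  have hfin := finite_integralClosure_of_isUnit k htu hD
  set C := integralClosure R D with hC
  have : IsNoetherian R C := isNoetherian_of_isNoetherianRing_of_finite R C
  have : IsNoetherianRing C := isNoetherianRing_iff.mpr (isNoetherian_of_tower R this)
  have hinj : Function.Injective (algebraMap C D) := Subtype.val_injective
  have : FaithfulSMul C D := (faithfulSMul_iff_algebraMap_injective C D).mpr hinj
  set τ : C := algebraMap R C t with hτ
  have hτu : IsUnit (algebraMap C D τ) := htu
  have hτn : ∀ n, algebraMap C D (τ ^ n) = algebraMap R D (t ^ n) := fun n => by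
    rw [map_pow, map_pow]; rfl
  have hτ0 : τ ≠ 0 := fun h => by simp [h] at hτu
  have hclosed : ∀ x : D, IsIntegral C x → x ∈ (algebraMap C D).range := fun x hx =>
    ⟨⟨x, isIntegral_trans x hx⟩, rfl⟩
  obtain ⟨s, hs, hv, hdvd⟩ := exists_finite_valuations_pow_dvd hclosed hτ0 hτu
  -- `D` is the localization of `C` at `τ`, so the valuations of `C` extend to `D`
  have hloc : IsLocalization.Away τ D := by
    refine ⟨⟨?_, fun x => ?_, fun {x y} h => ⟨1, by rw [hinj h]⟩⟩⟩
    · rintro ⟨_, n, rfl⟩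
      dsimp only
      rw [map_pow]
      exact hτu.pow n
    · obtain ⟨n, r, hr⟩ := hD x
      refine ⟨⟨algebraMap R C r, ⟨τ ^ n, n, rfl⟩⟩, ?_⟩
      rw [mul_comm, ← hτn] at hr
      exact hr
  have hsupp : ∀ v ∈ s, Submonoid.powers τ ≤ v.supp.primeCompl := by
    rintro v hvs _ ⟨n, rfl⟩ h
    have h1 : v (τ ^ n) = 0 := h
    rw [(hv v hvs).2.1] at h1
    exact pow_ne_zero n hτ0 h1
  set e : s → Valuation D ℤᵐ⁰ := fun v => v.1.extendToLocalization (hsupp v.1 v.2) D with he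
  have hev : ∀ (v : s) (c : C), e v (algebraMap C D c) = v.1 c := fun v c =>
    v.1.extendToLocalization_apply_map_apply _ D c
  have hτe : ∀ v : s, e v (algebraMap R D t) ≠ 0 := fun v h => by
    have h1 := hev v τ
    rw [← IsScalarTower.algebraMap_apply R C D, h] at h1
    exact hτ0 (((hv v.1 v.2).2.1 τ).mp h1.symm)
  have : Finite s := hs
  refine ⟨Set.range e, Set.finite_range e, ?_, fun x => ⟨?_, fun h => ?_⟩⟩
  · rintro _ ⟨v, rfl⟩
    refine ⟨fun r => ?_, fun x => ⟨fun h => ?_, fun h => by rw [h, map_zero]⟩, ?_⟩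
    · rw [IsScalarTower.algebraMap_apply R C D, hev]
      exact (hv v.1 v.2).1 _
    · obtain ⟨n, r, hr⟩ := hD x
      have h1 := congrArg (e v) hr
      rw [map_mul, h, mul_zero, IsScalarTower.algebraMap_apply R C D, hev, eq_comm,
        (hv v.1 v.2).2.1] at h1
      rw [IsScalarTower.algebraMap_apply R C D r, h1, map_zero, map_pow] at hr
      exact (mul_eq_zero.mp hr).resolve_left (pow_ne_zero n htu.ne_zero)
    · rw [IsScalarTower.algebraMap_apply R C D, hev]
      exact (hv v.1 v.2).2.2
  · rintro hx _ ⟨v, rfl⟩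
    exact (hev v ⟨x, hx⟩).trans_le ((hv v.1 v.2).1 _)
  · obtain ⟨n, r, hr⟩ := hD x
    have h1 : τ ^ n ∣ algebraMap R C r := by
      refine hdvd _ n fun v hvs => ?_
      rw [← hev ⟨v, hvs⟩, ← IsScalarTower.algebraMap_apply R C D, ← hr, map_mul,
        ← hev ⟨v, hvs⟩ (τ ^ n), hτn]
      exact mul_le_of_le_one_right' (h _ ⟨⟨v, hvs⟩, rfl⟩)
    obtain ⟨c, hc⟩ := h1
    have h2 : x = algebraMap C D c := by
      have h3 := congrArg (algebraMap C D) hc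
      rw [← IsScalarTower.algebraMap_apply R C D, ← hr, map_mul] at h3
      refine mul_left_cancel₀ (pow_ne_zero n htu.ne_zero) ?_
      rw [map_pow] at h3
      exact h3.trans (by rw [map_pow]; rfl)
    rw [h2]
    exact c.2

/-- If a finite family of algebra maps is jointly injective, then integrality is tested by the
family. -/
theorem isIntegral_iff_forall_of_jointly_injective {R E ι : Type*} [CommRing R] [CommRing E]
    [Algebra R E] [Finite ι] {D : ι → Type*} [∀ i, CommRing (D i)] [∀ i, Algebra R (D i)]
    (φ : ∀ i, E →ₐ[R] D i) (hφ : ∀ x, (∀ i, φ i x = 0) → x = 0) (x : E) :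
    IsIntegral R x ↔ ∀ i, IsIntegral R (φ i x) := by
  refine ⟨fun h i => h.map (φ i), fun h => ?_⟩
  have := Fintype.ofFinite ι
  choose p hp hpx using h
  -- the product of the integral equations works for all members of the family
  refine ⟨∏ i, p i, Polynomial.monic_prod_of_monic _ _ fun i _ => hp i, hφ _ fun i => ?_⟩
  rw [← Polynomial.aeval_def, ← Polynomial.aeval_algHom_apply, map_prod]
  exact Finset.prod_eq_zero (Finset.mem_univ i) (hpx i)

theorem finite_integralClosure_of_jointly_injective {R E ι : Type*} [CommRing R]
    [IsNoetherianRing R] [CommRing E]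
    [Algebra R E] [Finite ι] {D : ι → Type*} [∀ i, CommRing (D i)] [∀ i, Algebra R (D i)]
    (φ : ∀ i, E →ₐ[R] D i) (hφ : ∀ x, (∀ i, φ i x = 0) → x = 0)
    (hfin : ∀ i, Module.Finite R (integralClosure R (D i))) :
    Module.Finite R (integralClosure R E) := by
  let f : integralClosure R E →ₗ[R] ∀ i, integralClosure R (D i) :=
    LinearMap.pi fun i => ((φ i).mapIntegralClosure).toLinearMap
  refine Module.Finite.of_injective f ?_
  rw [injective_iff_map_eq_zero]
  intro x hx
  exact Subtype.ext (hφ _ fun i => congrArg Subtype.val (congrFun hx i))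

namespace DegreeLike

variable {k A : Type*} [Field k] [CommRing A] [Algebra k A]

theorem one_mem_filt (δ : DegreeLike k A) {d : ℤ} (hd : 0 ≤ d) : (1 : A) ∈ δ.filt d := by
  have h0 := δ.algebraMap_mem_filt 1
  rw [_root_.map_one] at h0
  exact δ.filt_mono hd h0

theorem exists_mem_filt (δ : DegreeLike k A) (f : A) : ∃ d : ℤ, f ∈ δ.filt d := by
  induction h : δ f with
  | bot => exact ⟨0, by rw [mem_filt, h]; exact bot_le⟩
  | coe d => exact ⟨d, by rw [mem_filt, h]⟩

/-- The element `t = (1)_1` of `A^δ`. -/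
def paramT (δ : DegreeLike k A) : δ.gradedRing :=
  ⟨AddMonoidAlgebra.single 1 1, δ.single_mem_gradedRing (δ.one_mem_filt zero_le_one)⟩

theorem coe_paramT_pow (δ : DegreeLike k A) (n : ℕ) :
    ((δ.paramT ^ n : δ.gradedRing) : LaurentPolynomial A) = AddMonoidAlgebra.single (n : ℤ) 1 := by
  change (AddMonoidAlgebra.single (1 : ℤ) (1 : A)) ^ n = _
  rw [AddMonoidAlgebra.single_pow, one_pow]
  simp

theorem isUnit_single_one (A : Type*) [CommRing A] (i : ℤ) :
    IsUnit (AddMonoidAlgebra.single i 1 : LaurentPolynomial A) := LaurentPolynomial.isUnit_T i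

/-- `A[t, t⁻¹]` is the localization of `A^δ` at `t`. -/
theorem exists_paramT_pow_mul_mem (δ : DegreeLike k A) (x : LaurentPolynomial A) :
    ∃ n : ℕ, (AddMonoidAlgebra.single (n : ℤ) 1 : LaurentPolynomial A) * x ∈ δ.gradedRing := by
  have hadd : ∀ n m : ℕ, (AddMonoidAlgebra.single ((n + m : ℕ) : ℤ) 1 : LaurentPolynomial A) =
      AddMonoidAlgebra.single (n : ℤ) 1 * AddMonoidAlgebra.single (m : ℤ) 1 := fun n m => by
    rw [AddMonoidAlgebra.single_mul_single, mul_one]; push_cast; rfl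
  have hmem : ∀ n : ℕ, (AddMonoidAlgebra.single (n : ℤ) 1 : LaurentPolynomial A) ∈ δ.gradedRing :=
    fun n => δ.single_mem_gradedRing (δ.one_mem_filt (Int.natCast_nonneg n))
  induction x using AddMonoidAlgebra.induction_linear with
  | zero => exact ⟨0, by rw [mul_zero]; exact δ.gradedRing.zero_mem⟩
  | add x y hx hy =>
    obtain ⟨n, hn⟩ := hx
    obtain ⟨m, hm⟩ := hy
    refine ⟨n + m, ?_⟩
    rw [mul_add, hadd]
    refine δ.gradedRing.add_mem ?_ ?_
    · rw [mul_comm (AddMonoidAlgebra.single (n : ℤ) 1), mul_assoc]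
      exact δ.gradedRing.mul_mem (hmem m) hn
    · rw [mul_assoc]
      exact δ.gradedRing.mul_mem (hmem n) hm
  | single i f =>
    obtain ⟨d, hd⟩ := δ.exists_mem_filt f
    refine ⟨(d - i).toNat, ?_⟩
    rw [AddMonoidAlgebra.single_mul_single, one_mul]
    exact δ.single_mem_gradedRing (δ.filt_mono (by omega) hd)

open WithZero in
/-- The filtration of the integral closure of `A^δ` in `A[t, t⁻¹]` is given by finitely many
discrete valuations, and this closure is finite over `A^δ`. In the pair `p`, the valuation `p.1` is the
restriction to `A` of a Rees valuation of `t`, and `p.2` is the (additive) value of `t`. -/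
theorem exists_valuations_isIntegral_single_iff [PerfectField k] [Infinite k]
    [IsReduced A] [Algebra.FiniteType k A] (δ : DegreeLike k A) (hfg : δ.IsFinitelyGenerated) :
    (∃ s : Set (Valuation A ℤᵐ⁰ × ℕ), s.Finite ∧
      (∀ p ∈ s, 0 < p.2 ∧ (∀ c : k, p.1 (algebraMap k A c) ≤ 1) ∧
        (IsDomain A → ∀ f, p.1 f = 0 → f = 0)) ∧
      ∀ (f : A) (i : ℤ),
        IsIntegral δ.gradedRing (AddMonoidAlgebra.single i f : LaurentPolynomial A) ↔
          ∀ p ∈ s, p.1 f ≤ exp (p.2 * i)) ∧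
      Module.Finite δ.gradedRing (integralClosure δ.gradedRing (LaurentPolynomial A)) := by
  have : Algebra.FiniteType k δ.gradedRing := hfg
  have : IsNoetherianRing δ.gradedRing := Algebra.FiniteType.isNoetherianRing k _
  have : IsNoetherianRing A := Algebra.FiniteType.isNoetherianRing k A
  have hfinite : Finite (minimalPrimes A) := minimalPrimes.finite_of_isNoetherianRing A
  have hprime : ∀ P : minimalPrimes A, P.1.IsPrime := fun P => P.2.isPrime
  -- reduction modulo the minimal primes; the family is jointly injective as `A` is reduced
  let q : ∀ P : minimalPrimes A, LaurentPolynomial A →+* LaurentPolynomial (A ⧸ P.1) := fun P =>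
    AddMonoidAlgebra.mapRingHom ℤ (Ideal.Quotient.mk P.1)
  let _ : ∀ P : minimalPrimes A, Algebra δ.gradedRing (LaurentPolynomial (A ⧸ P.1)) := fun P =>
    ((q P).comp (algebraMap δ.gradedRing (LaurentPolynomial A))).toAlgebra
  let φ : ∀ P : minimalPrimes A, LaurentPolynomial A →ₐ[δ.gradedRing]
    LaurentPolynomial (A ⧸ P.1) := fun P => { q P with commutes' := fun _ => rfl }
  have hqsingle : ∀ (P : minimalPrimes A) (i : ℤ) (f : A), q P (AddMonoidAlgebra.single i f) =
      AddMonoidAlgebra.single i (Ideal.Quotient.mk P.1 f) := fun P i f =>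
    AddMonoidAlgebra.mapRingHom_single _ _ _
  have hφ : ∀ x, (∀ P, φ P x = 0) → x = 0 := by
    intro x hx
    refine LaurentPolynomial.ext fun i => ?_
    have h1 : x.coeff i ∈ sInf (⊥ : Ideal A).minimalPrimes := by
      rw [Submodule.mem_sInf]
      intro P hP
      have h2 := congrArg (fun z : LaurentPolynomial (A ⧸ P) => z.coeff i) (hx ⟨P, hP⟩)
      exact Ideal.Quotient.eq_zero_iff_mem.mp h2
    rw [Ideal.sInf_minimalPrimes] at h1
    have h3 : (⊥ : Ideal A).radical = ⊥ := nilradical_eq_zero A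
    rw [h3] at h1
    exact h1
  have htq : ∀ P : minimalPrimes A, algebraMap δ.gradedRing (LaurentPolynomial (A ⧸ P.1)) δ.paramT
      = AddMonoidAlgebra.single 1 1 := fun P => (hqsingle P 1 1).trans (by rw [map_one])
  have htu : ∀ P : minimalPrimes A,
      IsUnit (algebraMap δ.gradedRing (LaurentPolynomial (A ⧸ P.1)) δ.paramT) := fun P => by
    rw [htq]
    exact isUnit_single_one _ _
  have hD : ∀ (P : minimalPrimes A) (x : LaurentPolynomial (A ⧸ P.1)), ∃ (n : ℕ)
      (r : δ.gradedRing), algebraMap δ.gradedRing (LaurentPolynomial (A ⧸ P.1)) (δ.paramT ^ n) * x =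
        algebraMap δ.gradedRing (LaurentPolynomial (A ⧸ P.1)) r := by
    intro P x
    obtain ⟨y, rfl⟩ : ∃ y, q P y = x := by
      induction x using AddMonoidAlgebra.induction_linear with
      | zero => exact ⟨0, map_zero _⟩
      | add x y hx hy =>
        obtain ⟨x, rfl⟩ := hx
        obtain ⟨y, rfl⟩ := hy
        exact ⟨x + y, map_add _ _ _⟩
      | single i f =>
        obtain ⟨f, rfl⟩ := Ideal.Quotient.mk_surjective f
        exact ⟨AddMonoidAlgebra.single i f, hqsingle P i f⟩
    obtain ⟨n, hn⟩ := δ.exists_paramT_pow_mul_mem y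
    refine ⟨n, ⟨_, hn⟩, ?_⟩
    change q P ((δ.paramT ^ n : δ.gradedRing) : LaurentPolynomial A) * q P y = q P _
    rw [coe_paramT_pow, ← map_mul]
    rfl
  refine ⟨?_, finite_integralClosure_of_jointly_injective φ hφ fun P =>
    finite_integralClosure_of_isUnit k (htu P) (hD P)⟩
  choose s hs hsv hsint using fun P => exists_finite_valuations_isIntegral_iff k (htu P) (hD P)
  let c : ∀ P : minimalPrimes A, A →+* LaurentPolynomial (A ⧸ P.1) := fun P =>
    (q P).comp LaurentPolynomial.C
  -- `n = -log v(t)` is the value of `t`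
  let g : (Σ P, s P) → Valuation A ℤᵐ⁰ × ℕ := fun v =>
    (v.2.1.comap (c v.1), (-log (v.2.1 (AddMonoidAlgebra.single 1 1))).toNat)
  have hvt : ∀ v : Σ P, s P, 0 < (g v).2 ∧
      v.2.1 (AddMonoidAlgebra.single 1 1) = exp (-((g v).2 : ℤ)) := by
    rintro ⟨P, v, hv⟩
    obtain ⟨-, h0, h1⟩ := hsv P v hv
    rw [htq] at h1
    have h2 : v (AddMonoidAlgebra.single 1 1) ≠ 0 := by
      rw [Ne, h0]
      exact (isUnit_single_one _ _).ne_zero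
    have h3 : log (v (AddMonoidAlgebra.single 1 1)) < 0 := by
      rw [← log_one, log_lt_log h2 one_ne_zero]
      exact h1
    have h4 : ((-log (v (AddMonoidAlgebra.single 1 1))).toNat : ℤ) =
        -log (v (AddMonoidAlgebra.single 1 1)) := Int.toNat_of_nonneg (by omega)
    constructor
    · change 0 < (-log (v (AddMonoidAlgebra.single 1 1))).toNat
      omega
    · change _ = exp (-((-log (v (AddMonoidAlgebra.single 1 1))).toNat : ℤ))
      rw [h4, neg_neg, exp_log h2]
  have hvi : ∀ (v : Σ P, s P) (i : ℤ),
      v.2.1 (AddMonoidAlgebra.single i 1) = exp (-((g v).2 * i : ℤ)) := by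
    intro v i
    have hpow : ∀ n : ℕ, v.2.1 (AddMonoidAlgebra.single (n : ℤ) 1) = exp (-((g v).2 * n : ℤ)) := by
      intro n
      have h1 : (AddMonoidAlgebra.single (n : ℤ) 1 : LaurentPolynomial (A ⧸ v.1.1)) =
          (AddMonoidAlgebra.single 1 1) ^ n := by
        rw [AddMonoidAlgebra.single_pow, one_pow]; simp
      rw [h1, map_pow, (hvt v).2, ← exp_nsmul, nsmul_eq_mul]
      congr 1; ring
    obtain ⟨n, rfl | rfl⟩ := i.eq_nat_or_neg
    · exact hpow n
    · have h1 : (AddMonoidAlgebra.single (-(n : ℤ)) 1 : LaurentPolynomial (A ⧸ v.1.1)) *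
          (AddMonoidAlgebra.single (n : ℤ) 1) = 1 := by
        rw [AddMonoidAlgebra.single_mul_single, neg_add_cancel, mul_one]; rfl
      have h2 := congrArg v.2.1 h1
      rw [map_mul, map_one, hpow] at h2
      rw [eq_inv_of_mul_eq_one_left h2, ← exp_neg]
      congr 1; ring
  have hfs : ∀ P, Finite (s P) := hs
  refine ⟨Set.range g, Set.finite_range g, ?_, fun f i => ?_⟩
  · rintro _ ⟨v, rfl⟩
    refine ⟨(hvt v).1, fun a => ?_, fun hA f hf => ?_⟩
    · exact (hsv v.1 v.2.1 v.2.2).1 (algebraMap k δ.gradedRing a)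
    · have h1 : c v.1 f = 0 := ((hsv v.1 v.2.1 v.2.2).2.1 _).mp hf
      have h2 : Ideal.Quotient.mk v.1.1 f = 0 := by
        have h3 : AddMonoidAlgebra.single (0 : ℤ) (Ideal.Quotient.mk v.1.1 f) = 0 :=
          (hqsingle v.1 0 f).symm.trans h1
        exact AddMonoidAlgebra.single_eq_zero.mp h3
      have h4 : ∀ P ∈ minimalPrimes A, P = ⊥ := by
        rw [IsDomain.minimalPrimes_eq_singleton_bot]
        exact fun P hP => hP
      rw [Ideal.Quotient.eq_zero_iff_mem, h4 v.1.1 v.1.2] at h2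
      exact h2
  · rw [isIntegral_iff_forall_of_jointly_injective φ hφ]
    have key : ∀ v : Σ P, s P,
        v.2.1 (φ v.1 (AddMonoidAlgebra.single i f)) ≤ 1 ↔ (g v).1 f ≤ exp ((g v).2 * i) := by
      intro v
      have h1 : φ v.1 (AddMonoidAlgebra.single i f) =
          c v.1 f * AddMonoidAlgebra.single i 1 := by
        have h2 : c v.1 f = AddMonoidAlgebra.single 0 (Ideal.Quotient.mk v.1.1 f) :=
          hqsingle v.1 0 f
        rw [h2, AddMonoidAlgebra.single_mul_single, zero_add, mul_one]
        exact hqsingle v.1 i f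
      rw [h1, map_mul, hvi, exp_neg, ← div_eq_mul_inv, div_le_one₀ exp_pos]
      rfl
    constructor
    · rintro h _ ⟨v, rfl⟩
      exact (key v).mp ((hsint v.1 _).mp (h v.1) v.2.1 v.2.2)
    · intro h P
      rw [hsint]
      intro v hv
      exact (key ⟨P, v, hv⟩).mpr (h _ ⟨⟨P, v, hv⟩, rfl⟩)

end DegreeLike

/-! ### Semidegrees from valuations, and the degree of an integral element -/

/-- If the integral closure of `R` in `R[t⁻¹]` is finite over `R`, then a power of `t` multiplies it
into `R`. -/
theorem exists_pow_mul_mem_range_of_finite {R E : Type*} [CommRing R] [CommRing E] [Algebra R E]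
    (hfin : Module.Finite R (integralClosure R E)) {t : R}
    (hE : ∀ x : E, ∃ (n : ℕ) (r : R), algebraMap R E (t ^ n) * x = algebraMap R E r) :
    ∃ c : ℕ, ∀ x : E, IsIntegral R x → ∃ r : R, algebraMap R E (t ^ c) * x = algebraMap R E r := by
  obtain ⟨S, hS⟩ := hfin
  choose n a hn using fun x : integralClosure R E => hE (x : E)
  refine ⟨S.sup n, fun x hx => ?_⟩
  have key : ∀ y ∈ Submodule.span R (S : Set (integralClosure R E)),
      ∃ r : R, algebraMap R E (t ^ S.sup n) * (y : E) = algebraMap R E r := by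
    intro y hy
    induction hy using Submodule.span_induction with
    | mem y hy =>
      refine ⟨t ^ (S.sup n - n y) * a y, ?_⟩
      rw [map_mul, ← hn, ← mul_assoc, ← map_mul, ← pow_add,
        Nat.sub_add_cancel (Finset.le_sup (f := n) hy)]
    | zero => exact ⟨0, by rw [ZeroMemClass.coe_zero, mul_zero, map_zero]⟩
    | add x y _ _ hx hy =>
      obtain ⟨r, hr⟩ := hx
      obtain ⟨s, hs⟩ := hy
      exact ⟨r + s, by rw [AddMemClass.coe_add, mul_add, hr, hs, map_add]⟩
    | smul b x _ hx =>
      obtain ⟨r, hr⟩ := hx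
      refine ⟨b * r, ?_⟩
      rw [map_mul, ← hr, Algebra.smul_def]
      exact mul_left_comm _ _ _
  exact key ⟨x, hx⟩ (by rw [hS]; trivial)

namespace DegreeLike

variable {k A : Type*} [Field k] [CommRing A] [Algebra k A]

/-- An element of `ℤ ∪ {-∞}` is determined by the integers above it. -/
theorem _root_.WithBot.le_of_forall_le_coe {x y : WithBot ℤ}
    (h : ∀ i : ℤ, y ≤ (i : WithBot ℤ) → x ≤ (i : WithBot ℤ)) : x ≤ y := by
  induction y with
  | coe b => exact h b le_rfl
  | bot =>
    induction x with
    | bot => exact le_rfl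
    | coe a =>
      have := h (a - 1) bot_le
      rw [WithBot.coe_le_coe] at this
      omega

theorem scale_coe (e : ℕ) (d : ℤ) : scale e (d : WithBot ℤ) = ((e * d : ℤ) : WithBot ℤ) := rfl

theorem scale_bot (e : ℕ) : scale e ⊥ = ⊥ := rfl

theorem scale_le_mul_iff {e : ℕ} (he : 0 < e) (x : WithBot ℤ) (i : ℤ) :
    scale e x ≤ ((e * i : ℤ) : WithBot ℤ) ↔ x ≤ (i : WithBot ℤ) := by
  rw [← scale_coe, (scale_strictMono he).le_iff_le]

/-- A function with all properties of a degree-like function but the strictness in the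
ultrametric inequality, which follows from the others. -/
def mkOfLe (φ : A → WithBot ℤ) (h0 : φ 0 = ⊥) (hc : ∀ c : k, φ (algebraMap k A c) ≤ 0)
    (hadd : ∀ f g : A, φ (f + g) ≤ max (φ f) (φ g)) (hmul : ∀ f g : A, φ (f * g) ≤ φ f + φ g) :
    DegreeLike k A where
  toFun := φ
  apply_zero := h0
  map_algebraMap_le := hc
  map_add_le := hadd
  eq_of_map_add_lt f g h := by
    have hneg : ∀ f, φ (-f) ≤ φ f := fun f => by
      have h1 := hmul (algebraMap k A (-1)) f
      rw [map_neg, map_one, neg_one_mul] at h1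
      refine h1.trans ?_
      have h2 := hc (-1)
      rw [map_neg, map_one] at h2
      simpa using add_le_add_left h2 (φ f)
    rcases lt_trichotomy (φ f) (φ g) with hlt | heq | hlt
    · rw [max_eq_right hlt.le] at h
      have h1 := hadd (f + g) (-f)
      rw [add_neg_cancel_comm] at h1
      exact absurd (h1.trans (max_le_max le_rfl (hneg f))) (not_le.mpr (max_lt h hlt))
    · exact heq
    · rw [max_eq_left hlt.le] at h
      have h1 := hadd (f + g) (-g)
      rw [add_neg_cancel_right] at h1
      exact absurd (h1.trans (max_le_max le_rfl (hneg g))) (not_le.mpr (max_lt h hlt))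
  map_mul_le := hmul

open WithZero in
/-- The logarithm `ℤᵐ⁰ → ℤ ∪ {-∞}`, with `0 ↦ -∞`. -/
def logBot (x : ℤᵐ⁰) : WithBot ℤ := if x = 0 then ⊥ else ((log x : ℤ) : WithBot ℤ)

open WithZero in
theorem logBot_le_coe_iff (x : ℤᵐ⁰) (i : ℤ) : logBot x ≤ (i : WithBot ℤ) ↔ x ≤ exp i := by
  unfold logBot
  split_ifs with h
  · simp [h]
  · rw [WithBot.coe_le_coe, log_le_iff_le_exp h]

open WithZero in
theorem logBot_eq_bot_iff (x : ℤᵐ⁰) : logBot x = ⊥ ↔ x = 0 := by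
  unfold logBot
  split_ifs with h <;> simp [h]

open WithZero in
theorem logBot_monotone : Monotone logBot := fun x y hxy =>
  WithBot.le_of_forall_le_coe fun i hi =>
    (logBot_le_coe_iff x i).mpr (hxy.trans ((logBot_le_coe_iff y i).mp hi))

open WithZero in
theorem logBot_mul (x y : ℤᵐ⁰) : logBot (x * y) = logBot x + logBot y := by
  by_cases hx : x = 0
  · simp [logBot, hx]
  by_cases hy : y = 0
  · simp [logBot, hy]
  simp [logBot, hx, hy, log_mul hx hy]

open WithZero in
/-- The semidegree `log ∘ v` of a valuation `v` that is at most `1` on constants. -/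
def ofValuation (v : Valuation A ℤᵐ⁰) (hv : ∀ c : k, v (algebraMap k A c) ≤ 1) :
    DegreeLike k A :=
  mkOfLe (fun f => logBot (v f)) ((logBot_eq_bot_iff _).mpr (map_zero v))
    (fun c => (logBot_le_coe_iff _ 0).mpr (hv c))
    (fun f g => by
      rw [← logBot_monotone.map_max]
      exact logBot_monotone (v.map_add f g))
    (fun f g => by rw [map_mul, logBot_mul])

/-- The pointwise maximum of finitely many degree-like functions. -/
def finMax {N : ℕ} (σ : Fin N → DegreeLike k A) : DegreeLike k A :=
  mkOfLe (fun f => Finset.univ.sup fun i => σ i f)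
    (by simp [DegreeLike.apply_zero])
    (fun c => Finset.sup_le fun i _ => (σ i).map_algebraMap_le c)
    (fun f g => Finset.sup_le fun i hi => ((σ i).map_add_le f g).trans
      (max_le_max (Finset.le_sup (f := fun i => σ i f) hi)
        (Finset.le_sup (f := fun i => σ i g) hi)))
    (fun f g => Finset.sup_le fun i hi => ((σ i).map_mul_le f g).trans
      (add_le_add (Finset.le_sup (f := fun i => σ i f) hi)
        (Finset.le_sup (f := fun i => σ i g) hi)))

theorem finMax_apply {N : ℕ} (σ : Fin N → DegreeLike k A) (f : A) :
    finMax σ f = Finset.univ.sup fun i => σ i f := rfl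

theorem map_pow_le (δ : DegreeLike k A) (f : A) {m : ℕ} (hm : 0 < m) :
    δ (f ^ m) ≤ scale m (δ f) := by
  induction m, hm using Nat.le_induction with
  | base =>
    rw [pow_one]
    induction δ f with
    | bot => exact bot_le
    | coe d => rw [scale_coe]; simp
  | succ m _ ih =>
    rw [pow_succ]
    refine (δ.map_mul_le _ _).trans ((add_le_add_left ih _).trans ?_)
    induction δ f with
    | bot => simp
    | coe d =>
      rw [scale_coe, scale_coe, ← WithBot.coe_add, WithBot.coe_le_coe]
      push_cast; linarith

theorem IsSemidegree.map_pow {σ : DegreeLike k A} (hσ : σ.IsSemidegree) (f : A) {m : ℕ}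
    (hm : 0 < m) : σ (f ^ m) = scale m (σ f) := by
  induction m, hm using Nat.le_induction with
  | base =>
    rw [pow_one]
    induction σ f with
    | bot => rfl
    | coe d => rw [scale_coe]; simp
  | succ m _ ih =>
    rw [pow_succ, hσ, ih]
    induction σ f with
    | bot => simp [scale_bot]
    | coe d =>
      rw [scale_coe, scale_coe, ← WithBot.coe_add, WithBot.coe_inj]
      push_cast; ring

theorem finMax_map_pow {N : ℕ} {σ : Fin N → DegreeLike k A} (hσ : ∀ i, (σ i).IsSemidegree)
    (f : A) {m : ℕ} (hm : 0 < m) : finMax σ (f ^ m) = scale m (finMax σ f) := by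
  rw [finMax_apply, finMax_apply,
    Finset.apply_sup_eq_sup_comp_of_linearOrder _ (scale_strictMono hm).monotone (scale_bot m)]
  exact Finset.sup_congr rfl fun i _ => (hσ i).map_pow f hm

/-- The maximum of finitely many semidegrees that describes the integral closure of `A^δ` in
`A[t, t⁻¹]`. It is not required that `0 < N`. -/
theorem exists_finMax_le_iff_isIntegral [PerfectField k] [Infinite k]
    [IsReduced A] [Algebra.FiniteType k A] (δ : DegreeLike k A) (hfg : δ.IsFinitelyGenerated) :
    ∃ (e : ℕ) (_ : 0 < e) (N : ℕ) (σ : Fin N → DegreeLike k A),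
      (∀ j, (σ j).IsSemidegree) ∧ (IsDomain A → ∀ j, (σ j).IsIntegerValued) ∧
      ∀ (f : A) (i : ℤ), finMax σ f ≤ ((e * i : ℤ) : WithBot ℤ) ↔
        IsIntegral δ.gradedRing (AddMonoidAlgebra.single i f : LaurentPolynomial A) := by
  obtain ⟨⟨s, hs, hv, hint⟩, -⟩ := δ.exists_valuations_isIntegral_single_iff hfg
  set E := hs.toFinset.equivFin.symm with hE
  have hmem : ∀ j, (E j).1 ∈ s := fun j => hs.mem_toFinset.mp (E j).2
  set n : Fin hs.toFinset.card → ℕ := fun j => (E j).1.2 with hn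
  have hn0 : ∀ j, 0 < n j := fun j => (hv _ (hmem j)).1
  -- a common multiple of the values of `t`
  set e := ∏ j, n j with he
  have hdvd : ∀ j, n j ∣ e := fun j => Finset.dvd_prod_of_mem n (Finset.mem_univ j)
  have he0 : 0 < e := Finset.prod_pos fun j _ => hn0 j
  have hdiv : ∀ j, 0 < e / n j := fun j => Nat.div_pos (Nat.le_of_dvd he0 (hdvd j)) (hn0 j)
  set w : ∀ j, DegreeLike k A := fun j => ofValuation (E j).1.1 (hv _ (hmem j)).2.1 with hw
  have hwmul : ∀ j f g, w j (f * g) = w j f + w j g := fun j f g =>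
    (congrArg logBot (map_mul (E j).1.1 f g)).trans (logBot_mul _ _)
  refine ⟨e, he0, _, fun j => (w j).mul (e / n j) (hdiv j), fun j f g => ?_, fun hA j f hf h => ?_,
    fun f i => ?_⟩
  · change scale _ (w j (f * g)) = scale _ (w j f) + scale _ (w j g)
    rw [← scale_add, hwmul]
  · have h1 : scale (e / n j) (w j f) = scale (e / n j) ⊥ := h
    have h2 : logBot ((E j).1.1 f) = ⊥ := (scale_strictMono (hdiv j)).injective h1
    rw [logBot_eq_bot_iff] at h2
    exact hf ((hv _ (hmem j)).2.2 hA f h2)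
  · rw [hint, finMax_apply, Finset.sup_le_iff]
    have key : ∀ j, (w j).mul (e / n j) (hdiv j) f ≤ ((e * i : ℤ) : WithBot ℤ) ↔
        (E j).1.1 f ≤ WithZero.exp ((E j).1.2 * i) := by
      intro j
      have h1 : (e * i : ℤ) = ((e / n j : ℕ) : ℤ) * (n j * i) := by
        rw [← mul_assoc, ← Nat.cast_mul, Nat.div_mul_cancel (hdvd j)]
      rw [h1]
      exact (scale_le_mul_iff (hdiv j) _ _).trans (logBot_le_coe_iff _ _)
    constructor
    · intro h p hp
      obtain ⟨j, hj⟩ := E.surjective ⟨p, hs.mem_toFinset.mpr hp⟩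
      have h1 := (key j).mp (h j (Finset.mem_univ j))
      rwa [hj] at h1
    · exact fun h j _ => (key j).mpr (h _ (hmem j))

/-- The conductor of `A^δ` in its integral closure contains a power of `t`. -/
theorem exists_single_mul_mem_of_finite (δ : DegreeLike k A)
    (hfin : Module.Finite δ.gradedRing (integralClosure δ.gradedRing (LaurentPolynomial A))) :
    ∃ c : ℕ, ∀ x : LaurentPolynomial A, IsIntegral δ.gradedRing x →
      AddMonoidAlgebra.single (c : ℤ) 1 * x ∈ δ.gradedRing := by
  obtain ⟨c, hc⟩ := exists_pow_mul_mem_range_of_finite hfin (t := δ.paramT) fun x => by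
    obtain ⟨n, hn⟩ := δ.exists_paramT_pow_mul_mem x
    refine ⟨n, ⟨_, hn⟩, ?_⟩
    change ((δ.paramT ^ n : δ.gradedRing) : LaurentPolynomial A) * x = _
    rw [coe_paramT_pow]
    rfl
  refine ⟨c, fun x hx => ?_⟩
  obtain ⟨r, hr⟩ := hc x hx
  rw [← δ.coe_paramT_pow c]
  exact hr ▸ r.2

theorem mem_of_forall_single_mem {R : Type*} [CommRing R] [Algebra R (LaurentPolynomial A)]
    (S : Subalgebra R (LaurentPolynomial A))
    (x : LaurentPolynomial A) (h : ∀ i : ℤ, AddMonoidAlgebra.single i (x.coeff i) ∈ S) : x ∈ S := by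
  rw [← AddMonoidAlgebra.sum_coeff_single x]
  exact S.sum_mem fun i _ => h i

/-- The substitution `t ↦ t^e`, as an endomorphism of `A[t, t⁻¹]`. -/
def powSubst (k A : Type*) [Field k] [CommRing A] [Algebra k A] (e : ℕ) :
    LaurentPolynomial A →ₐ[k] LaurentPolynomial A :=
  AddMonoidAlgebra.mapDomainAlgHom k A (AddMonoidHom.mulLeft (e : ℤ))

theorem powSubst_single (e : ℕ) (i : ℤ) (f : A) :
    powSubst k A e (AddMonoidAlgebra.single i f) = AddMonoidAlgebra.single (e * i) f :=
  AddMonoidAlgebra.mapDomain_single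

theorem powSubst_mem (δ : DegreeLike k A) {e : ℕ} (he : 0 < e) {x : LaurentPolynomial A}
    (hx : x ∈ δ.gradedRing) : powSubst k A e x ∈ (δ.mul e he).gradedRing := by
  refine mem_of_forall_single_mem ((δ.mul e he).gradedRing.comap (powSubst k A e)) x fun i => ?_
  rw [Subalgebra.mem_comap, powSubst_single]
  exact (δ.mul e he).single_mem_gradedRing ((scale_le_mul_iff he _ _).mpr (hx i))

/-- `A^{eδ}` is generated by `t` and the image of `A^δ` under `t ↦ t^e`. -/
theorem mul_isFinitelyGenerated {δ : DegreeLike k A} (hfg : δ.IsFinitelyGenerated) {e : ℕ}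
    (he : 0 < e) : (δ.mul e he).IsFinitelyGenerated := by
  have h1 : δ.gradedRing.FG := Subalgebra.fg_iff_finiteType _ |>.mpr hfg
  have hone : (AddMonoidAlgebra.single 1 1 : LaurentPolynomial A) ∈ (δ.mul e he).gradedRing :=
    (δ.mul e he).single_mem_gradedRing ((δ.mul e he).one_mem_filt zero_le_one)
  have h2 : (δ.mul e he).gradedRing = δ.gradedRing.map (powSubst k A e) ⊔
      Algebra.adjoin k {(AddMonoidAlgebra.single 1 1 : LaurentPolynomial A)} := by
    refine le_antisymm (fun x hx => ?_) (sup_le ?_ (Algebra.adjoin_le (by simpa using hone)))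
    · -- for `f` of `e δ`-degree at most `i`, `f t^i = (f t^{e ⌊i/e⌋}) t^{i mod e}`
      refine mem_of_forall_single_mem _ x fun i => ?_
      have h3 := hx i
      have hdm := Int.emod_add_mul_ediv i e
      have hr0 := Int.emod_nonneg i (b := e) (by omega)
      have hr1 := Int.emod_lt_of_pos i (b := e) (by omega)
      have h4 : δ (x.coeff i) ≤ ((i / e : ℤ) : WithBot ℤ) := by
        have h5 : scale e (δ (x.coeff i)) ≤ (i : WithBot ℤ) := h3
        induction h6 : δ (x.coeff i) with
        | bot => exact bot_le
        | coe d =>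
          rw [h6, scale_coe, WithBot.coe_le_coe] at h5
          rw [WithBot.coe_le_coe]
          exact Int.le_ediv_of_mul_le (by omega) (by linarith)
      have h5 : (AddMonoidAlgebra.single i (x.coeff i) : LaurentPolynomial A) =
          powSubst k A e (AddMonoidAlgebra.single (i / e) (x.coeff i)) *
            (AddMonoidAlgebra.single 1 1) ^ (i % e).toNat := by
        rw [powSubst_single, AddMonoidAlgebra.single_pow, AddMonoidAlgebra.single_mul_single,
          one_pow, mul_one]
        congr 1
        rw [nsmul_one, Int.natCast_toNat_eq_self.mpr hr0]
        linarith
      rw [h5]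
      refine mul_mem (le_sup_left (a := δ.gradedRing.map (powSubst k A e))
        ⟨_, δ.single_mem_gradedRing h4, rfl⟩) (pow_mem ?_ _)
      exact le_sup_right (a := δ.gradedRing.map (powSubst k A e)) (Algebra.subset_adjoin rfl)
    · rintro _ ⟨x, hx, rfl⟩
      exact δ.powSubst_mem he hx
  have h3 : (δ.mul e he).gradedRing.FG := by
    rw [h2]
    exact (h1.map _).sup ⟨{AddMonoidAlgebra.single 1 1}, by simp⟩
  exact (Subalgebra.fg_iff_finiteType _).mp h3

/-- If `η ≤ ε ≤ η + N`, then `A^η` is a finite module over the Noetherian ring `A^ε`, being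
isomorphic to the ideal `t^N A^η`. -/
theorem isIntegralOver_and_isFinitelyGenerated {η ε : DegreeLike k A}
    (hε : ε.IsFinitelyGenerated) (hle : ∀ f, η f ≤ ε f) {N : ℕ}
    (hN : ∀ f, ε f ≤ η f + ((N : ℤ) : WithBot ℤ)) :
    η.IsIntegralOver ε ∧ η.IsFinitelyGenerated := by
  have : Algebra.FiniteType k ε.gradedRing := hε
  have : IsNoetherianRing ε.gradedRing := Algebra.FiniteType.isNoetherianRing k _
  have hsub : ε.gradedRing ≤ η.gradedRing := fun x hx i => (hle _).trans (hx i)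
  -- `A^η` as an `A^ε`-algebra
  let S : Subalgebra ε.gradedRing (LaurentPolynomial A) :=
    { η.gradedRing with algebraMap_mem' := fun r => hsub r.2 }
  have hmul : ∀ x ∈ η.gradedRing,
      (AddMonoidAlgebra.single (N : ℤ) 1 : LaurentPolynomial A) * x ∈ ε.gradedRing := by
    intro x hx i
    rw [AddMonoidAlgebra.coeff_single_mul_apply, one_mul, mem_filt]
    refine (hN _).trans ((add_le_add_left (hx _) _).trans ?_)
    rw [← WithBot.coe_add, WithBot.coe_le_coe]
    omega
  let g : S →ₗ[ε.gradedRing] ε.gradedRing :=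
    { toFun x := ⟨_, hmul x.1 x.2⟩
      map_add' x y := Subtype.ext (mul_add _ _ _)
      map_smul' r x := Subtype.ext (mul_left_comm _ r.1 x.1) }
  have hg : Function.Injective g := fun x y hxy =>
    Subtype.ext ((isUnit_single_one A N).mul_left_cancel (congrArg Subtype.val hxy))
  have hS : Module.Finite ε.gradedRing S := Module.Finite.of_injective g hg
  refine ⟨⟨hle, fun x hx => ?_⟩, ?_⟩
  · exact IsIntegral.of_mem_of_fg S (Module.Finite.iff_fg.mp hS) x hx
  · have h1 : Algebra.FiniteType k S :=
      Algebra.FiniteType.trans (S := ε.gradedRing) hε inferInstance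
    exact h1

/-- The bounds `η ≤ e δ ≤ η + N`, applied to `f^m` and divided by `m`, squeeze `e δ(f^m) / m`. -/
theorem tendsto_of_power_homogeneous [IsReduced A] {δ η : DegreeLike k A} {e : ℕ} (he : 0 < e)
    (hint : δ.IsIntegerValued)
    (hpow : ∀ (f : A) (m : ℕ), 0 < m → η (f ^ m) = scale m (η f))
    (hle : ∀ f, η f ≤ δ.mul e he f) {N : ℕ}
    (hN : ∀ f, δ.mul e he f ≤ η f + ((N : ℤ) : WithBot ℤ)) {f : A} (hf : f ≠ 0) {d : ℤ}
    (hd : η f = (d : WithBot ℤ)) :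
    Filter.Tendsto (fun m : ℕ => (e : ℝ) * (((δ (f ^ m)).unbotD 0 : ℤ) : ℝ) / (m : ℝ))
      Filter.atTop (nhds (d : ℝ)) := by
  have key : ∀ m : ℕ, 0 < m → m * d ≤ e * (δ (f ^ m)).unbotD 0 ∧
      e * (δ (f ^ m)).unbotD 0 ≤ m * d + N := by
    intro m hm
    have h1 := hpow f m hm
    rw [hd, scale_coe] at h1
    have h2 := hle (f ^ m)
    have h3 := hN (f ^ m)
    have h4 : δ.mul e he (f ^ m) = scale e (δ (f ^ m)) := rfl
    rw [h4, h1] at h2 h3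
    obtain ⟨a, ha⟩ := WithBot.ne_bot_iff_exists.mp (hint _ (pow_ne_zero m hf))
    rw [← ha, scale_coe, WithBot.coe_le_coe] at h2
    rw [← ha, scale_coe, ← WithBot.coe_add, WithBot.coe_le_coe] at h3
    rw [← ha, WithBot.unbotD_coe]
    exact ⟨h2, h3⟩
  have hlim : Filter.Tendsto (fun m : ℕ => (d : ℝ) + (N : ℝ) / (m : ℝ)) Filter.atTop
      (nhds (d : ℝ)) := by
    simpa using
      (tendsto_const_nhds (x := (d : ℝ))).add (tendsto_const_div_atTop_nhds_zero_nat (N : ℝ))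
  refine tendsto_of_tendsto_of_tendsto_of_le_of_le' tendsto_const_nhds hlim ?_ ?_
  all_goals
    filter_upwards [Filter.eventually_gt_atTop 0] with m hm
    have hm' : (0 : ℝ) < m := by exact_mod_cast hm
    obtain ⟨h1, h2⟩ := key m hm
  · rw [le_div_iff₀ hm', mul_comm]
    exact_mod_cast h1
  · rw [div_le_iff₀ hm', add_mul, div_mul_cancel₀ _ hm'.ne', mul_comm (d : ℝ)]
    exact_mod_cast h2

/-- If `η f < 0`, then `e δ(f^m) ≤ m η(f) + N` is negative for large `m`, so that `f` is nilpotent. -/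
theorem isNonneg_of_power_homogeneous [IsReduced A] {δ η : DegreeLike k A} {e : ℕ} (he : 0 < e)
    (hpow : ∀ (f : A) (m : ℕ), 0 < m → η (f ^ m) = scale m (η f)) {N : ℕ}
    (hN : ∀ f, δ.mul e he f ≤ η f + ((N : ℤ) : WithBot ℤ)) (hδ : δ.IsNonneg) : η.IsNonneg := by
  intro i hi
  rw [Submodule.eq_bot_iff]
  intro f hf
  -- `m = N + 1` is large enough, as `η f ≤ -1`
  have h1 : δ (f ^ (N + 1)) ≤ ((-1 : ℤ) : WithBot ℤ) := by
    have h2 := (hN (f ^ (N + 1))).trans (add_le_add_left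
      ((hpow f (N + 1) N.succ_pos).le.trans ((scale_strictMono N.succ_pos).monotone hf)) _)
    have h3 : δ.mul e he (f ^ (N + 1)) = scale e (δ (f ^ (N + 1))) := rfl
    rw [scale_coe, ← WithBot.coe_add, h3] at h2
    induction h4 : δ (f ^ (N + 1)) with
    | bot => exact bot_le
    | coe a =>
      rw [h4, scale_coe, WithBot.coe_le_coe] at h2
      rw [WithBot.coe_le_coe]
      push_cast at h2
      by_contra h5
      have h6 : 0 ≤ (e : ℤ) * a := mul_nonneg (by omega) (by omega)
      nlinarith
  have h2 : f ^ (N + 1) ∈ δ.filt (-1) := h1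
  rw [hδ (-1) (by omega), Submodule.mem_bot] at h2
  exact pow_eq_zero_iff N.succ_ne_zero |>.mp h2

/-- The constant function `-∞`. -/
def constBot (k A : Type*) [Field k] [CommRing A] [Algebra k A] : DegreeLike k A :=
  mkOfLe (fun _ => ⊥) rfl (fun _ => bot_le) (fun _ _ => bot_le) (fun _ _ => bot_le)

end DegreeLike

/-! ### Points at infinity and contraction of homogeneous primes -/

namespace DegreeLike

variable {k A : Type*} [Field k] [CommRing A] [Algebra k A]

/-- The homogeneous components of an element of `A^δ` are its terms. -/
theorem coe_decompose_piece (δ : DegreeLike k A) (h : δ.IsNonneg) (x : δ.gradedRing) (d : ℕ) :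
    letI := δ.gradedAlgebra h
    ((DirectSum.decompose δ.piece x d : δ.piece d) : δ.gradedRing).1 =
      AddMonoidAlgebra.single (d : ℤ) (x.1.coeff d) := by
  classical
  let _ := δ.gradedAlgebra h
  have h1 := δ.coeff_coeAddMonoidHom_piece (DirectSum.decompose δ.piece x) d
  have h2 : DirectSum.coeAddMonoidHom δ.piece (DirectSum.decompose δ.piece x) = x :=
    (DirectSum.decompose δ.piece).symm_apply_apply x
  rw [h2] at h1
  refine LaurentPolynomial.ext fun i => ?_
  rw [AddMonoidAlgebra.coeff_single, Finsupp.single_apply]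
  split_ifs with hi
  · rw [← hi, ← h1]
  · exact (DirectSum.decompose δ.piece x d).2 i (Ne.symm hi)

/-- The term of degree `i` of an element of `A^δ`, as an element of `A^δ`. -/
def term (δ : DegreeLike k A) (x : δ.gradedRing) (i : ℤ) : δ.gradedRing :=
  ⟨AddMonoidAlgebra.single i (x.1.coeff i), δ.single_mem_gradedRing (x.2 i)⟩

theorem sum_term (δ : DegreeLike k A) (x : δ.gradedRing) :
    ∑ i ∈ x.1.coeff.support, δ.term x i = x :=
  Subtype.ext ((AddSubmonoidClass.coe_finsetSum _ _).trans (AddMonoidAlgebra.sum_coeff_single x.1))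

theorem isHomogeneous_iff_term_mem (δ : DegreeLike k A) (h : δ.IsNonneg) (I : Ideal δ.gradedRing) :
    letI := δ.gradedAlgebra h
    I.IsHomogeneous δ.piece ↔ ∀ x ∈ I, ∀ i, δ.term x i ∈ I := by
  let _ := δ.gradedAlgebra h
  have key : ∀ (x : δ.gradedRing) (d : ℕ),
      ((DirectSum.decompose δ.piece x d : δ.piece d) : δ.gradedRing) = δ.term x d :=
    fun x d => Subtype.ext (δ.coe_decompose_piece h x d)
  constructor
  · intro hI x hx i
    rcases lt_or_ge i 0 with hi | hi
    · have : δ.term x i = 0 := Subtype.ext (by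
        change AddMonoidAlgebra.single i (x.1.coeff i) = 0
        rw [δ.coeff_eq_zero_of_neg h x i hi, AddMonoidAlgebra.single_zero])
      rw [this]
      exact I.zero_mem
    · lift i to ℕ using hi
      rw [← key]
      exact hI i hx
  · intro hI d x hx
    rw [key]
    exact hI x hx d

/-- A homogeneous prime ideal that does not contain `t` comes from a prime ideal of `A`, namely from
the set of coefficients of its homogeneous elements. -/
theorem mem_range_psi_of_paramT_notMem (δ : DegreeLike k A) (h : δ.IsNonneg) (q : δ.ProjSpace h)
    (hq : letI := δ.gradedAlgebra h; δ.paramT ∉ q.asHomogeneousIdeal.toIdeal) :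
    q ∈ Set.range (δ.psi h) := by
  let _ := δ.gradedAlgebra h
  set I := q.asHomogeneousIdeal.toIdeal with hI
  have hprime : I.IsPrime := q.isPrime
  have hterm := (δ.isHomogeneous_iff_term_mem h I).mp q.asHomogeneousIdeal.2
  have htn : ∀ n : ℕ, δ.paramT ^ n ∉ I := fun n hn => hq (hprime.mem_of_pow_mem n hn)
  -- `mem f` says that `f` is the coefficient of some single term in `I`
  let mem : A → Prop := fun f => ∃ n : ℕ, ∃ x ∈ I, x.1 = AddMonoidAlgebra.single (n : ℤ) f
  have hmul_t : ∀ (x : δ.gradedRing) (f : A) (n m : ℕ), x.1 = AddMonoidAlgebra.single (n : ℤ) f →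
      (x * δ.paramT ^ m).1 = AddMonoidAlgebra.single ((n + m : ℕ) : ℤ) f := by
    intro x f n m hx
    change x.1 * (δ.paramT ^ m : δ.gradedRing).1 = _
    rw [hx, coe_paramT_pow, AddMonoidAlgebra.single_mul_single, mul_one, Nat.cast_add]
  -- membership does not depend on the degree in which it is tested
  have hmem : ∀ (x : δ.gradedRing) (f : A) (n : ℕ), x.1 = AddMonoidAlgebra.single (n : ℤ) f →
      mem f → x ∈ I := by
    rintro x f n hx ⟨m, y, hy, hyf⟩
    have h1 : x * δ.paramT ^ m = y * δ.paramT ^ n :=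
      Subtype.ext ((hmul_t x f n m hx).trans (by rw [hmul_t y f m n hyf, Nat.add_comm]))
    exact (hprime.mem_or_mem (h1 ▸ I.mul_mem_right _ hy)).resolve_right (htn m)
  have hexists : ∀ f : A, ∃ (n : ℕ) (x : δ.gradedRing),
      x.1 = AddMonoidAlgebra.single (n : ℤ) f := by
    intro f
    obtain ⟨n, hn⟩ := δ.exists_mem_filt f
    exact ⟨n.toNat, ⟨_, δ.single_mem_gradedRing (δ.filt_mono (Int.self_le_toNat n) hn)⟩, rfl⟩
  let P : Ideal A :=
    { carrier := {f | mem f}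
      zero_mem' := ⟨0, 0, I.zero_mem, by simp⟩
      add_mem' := by
        rintro f g ⟨n, x, hx, hxf⟩ ⟨m, y, hy, hyg⟩
        refine ⟨n + m, x * δ.paramT ^ m + y * δ.paramT ^ n,
          I.add_mem (I.mul_mem_right _ hx) (I.mul_mem_right _ hy), ?_⟩
        change (x * δ.paramT ^ m).1 + (y * δ.paramT ^ n).1 = _
        rw [hmul_t x f n m hxf, hmul_t y g m n hyg, Nat.add_comm m n, AddMonoidAlgebra.single_add]
      smul_mem' := by
        rintro c f ⟨n, x, hx, hxf⟩
        obtain ⟨m, y, hy⟩ := hexists c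
        refine ⟨m + n, y * x, I.mul_mem_left _ hx, ?_⟩
        change y.1 * x.1 = _
        rw [hy, hxf, AddMonoidAlgebra.single_mul_single, Nat.cast_add, smul_eq_mul] }
  have hP : P.IsPrime := by
    refine ⟨fun htop => ?_, fun {f g} hfg => ?_⟩
    · have h1 : (1 : A) ∈ P := htop ▸ Submodule.mem_top
      refine htn 1 (hmem _ 1 1 ?_ h1)
      rw [coe_paramT_pow]
    · obtain ⟨n, x, hx⟩ := hexists f
      obtain ⟨m, y, hy⟩ := hexists g
      have h1 : x * y ∈ I := hmem _ (f * g) (n + m) (by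
        change x.1 * y.1 = _
        rw [hx, hy, AddMonoidAlgebra.single_mul_single, Nat.cast_add]) hfg
      exact (hprime.mem_or_mem h1).imp (fun h2 => ⟨n, x, h2, hx⟩) fun h2 => ⟨m, y, h2, hy⟩
  refine ⟨⟨P, hP⟩, ?_⟩
  refine ProjectiveSpectrum.ext (HomogeneousIdeal.toIdeal_injective ?_)
  change δ.homogenization P = I
  ext x
  rw [mem_homogenization]
  have hneg : ∀ i : ℤ, i < 0 → x.1.coeff i = 0 := δ.coeff_eq_zero_of_neg h x
  constructor
  · intro hx
    rw [← δ.sum_term x]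
    refine I.sum_mem fun i hi => ?_
    rcases lt_or_ge i 0 with hi0 | hi0
    · exact absurd (hneg i hi0) (Finsupp.mem_support_iff.mp hi)
    · lift i to ℕ using hi0
      exact hmem _ _ i rfl (hx i)
  · intro hx i
    rcases lt_or_ge i 0 with hi0 | hi0
    · rw [hneg i hi0]
      exact P.zero_mem
    · lift i to ℕ using hi0
      exact ⟨i, δ.term x i, hterm x hx i, rfl⟩

theorem paramT_notMem_homogenization (δ : DegreeLike k A) (P : Ideal A) [hP : P.IsPrime] :
    δ.paramT ∉ δ.homogenization P := by
  intro hx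
  have h1 := hx 1
  have h2 : (δ.paramT.1.coeff 1 : A) = 1 := by
    have h3 := δ.coe_paramT_pow 1
    rw [pow_one] at h3
    rw [h3]
    exact Finsupp.single_eq_same
  rw [h2] at h1
  exact hP.ne_top ((Ideal.eq_top_iff_one P).mpr h1)

/-- An integral equation for `f t^d` over `A^ε` has a component of top degree, which is an
equation for `f` whose coefficients have bounded degrees. -/
theorem exists_equation_of_isIntegral (ε : DegreeLike k A) {d : ℤ} {f : A}
    (hf : IsIntegral ε.gradedRing (AddMonoidAlgebra.single d f : LaurentPolynomial A)) :
    ∃ (n : ℕ) (a : ℕ → A), (∀ j < n, ε (a j) ≤ ((d * (n - j) : ℤ) : WithBot ℤ)) ∧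
      f ^ n + ∑ j ∈ Finset.range n, a j * f ^ j = 0 := by
  obtain ⟨p, hp, hpf⟩ := hf
  refine ⟨p.natDegree, fun j => (p.coeff j).1.coeff (d * (p.natDegree - j)), fun j _ =>
    (p.coeff j).2 _, ?_⟩
  have hsum := hpf
  rw [Polynomial.eval₂_eq_sum_range, Finset.sum_range_succ, hp.coeff_natDegree, map_one, one_mul]
    at hsum
  have hc := congrArg (fun z : LaurentPolynomial A => z.coeff (p.natDegree * d)) hsum
  simp only [AddMonoidAlgebra.single_pow, AddMonoidAlgebra.coeff_add, Finsupp.add_apply,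
    AddMonoidAlgebra.coeff_sum, Finsupp.finsetSum_apply, nsmul_eq_mul,
    AddMonoidAlgebra.coeff_single, Finsupp.single_eq_same] at hc
  rw [add_comm]
  refine Eq.trans ?_ hc
  congr 1
  refine Finset.sum_congr rfl fun j _ => ?_
  rw [AddMonoidAlgebra.coeff_mul_single_apply,
    show (p.natDegree * d + -(j * d) : ℤ) = d * (p.natDegree - j) by ring]
  rfl

theorem mem_closure_psi_image_iff (δ : DegreeLike k A) (h : δ.IsNonneg)
    (X : Set (PrimeSpectrum A)) (q : δ.ProjSpace h) :
    letI := δ.gradedAlgebra h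
    q ∈ closure (δ.psi h '' X) ↔ ∀ x : δ.gradedRing, (∀ P ∈ X, x ∈ δ.homogenization P.asIdeal) →
      x ∈ q.asHomogeneousIdeal.toIdeal := by
  let _ := δ.gradedAlgebra h
  have h1 := ProjectiveSpectrum.zeroLocus_vanishingIdeal_eq_closure δ.piece (δ.psi h '' X)
  refine (Set.ext_iff.mp h1 q).symm.trans ?_
  rw [ProjectiveSpectrum.mem_zeroLocus]
  refine forall_congr' fun x => ?_
  rw [SetLike.mem_coe, ProjectiveSpectrum.mem_vanishingIdeal]
  exact imp_congr_left Set.forall_mem_image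

/-- Contracting relevant homogeneous primes along `t ↦ t^e` gives a map `Proj A^η → Proj A^δ`,
because the irrelevant ideal of `A^η` is integral over the one of `A^{eδ}`. It sends `ψ_η(P)` to
`ψ_δ(P)` and points at infinity to points at infinity. -/
theorem preservesIntersectionsAtInfinity_of_isIntegralOver {δ η : DegreeLike k A} {e : ℕ}
    (he : 0 < e) (hη : η.IsNonneg) (hδ : δ.IsNonneg) (hint : η.IsIntegralOver (δ.mul e he)) :
    η.PreservesIntersectionsAtInfinity δ hη hδ := by
  intro n X _ hX
  let _ := δ.gradedAlgebra hδ
  let _ := η.gradedAlgebra hη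
  have hsub : (δ.mul e he).gradedRing ≤ η.gradedRing := fun x hx i => (hint.1 _).trans (hx i)
  let φ : δ.gradedRing →+* η.gradedRing :=
    ((powSubst k A e).toRingHom.comp δ.gradedRing.val.toRingHom).codRestrict
      η.gradedRing.toSubring fun x => hsub (δ.powSubst_mem he x.2)
  have hφ : ∀ x : δ.gradedRing, (φ x).1 = powSubst k A e x.1 := fun x => rfl
  have hφ1 : ∀ (x : δ.gradedRing) (i : ℤ) (f : A), x.1 = AddMonoidAlgebra.single i f →
      (φ x).1 = AddMonoidAlgebra.single (e * i) f := fun x i f hx => by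
    rw [hφ, hx, powSubst_single]
  have hcoeff : ∀ (x : δ.gradedRing) (i : ℤ), (φ x).1.coeff (e * i) = x.1.coeff i := fun x i =>
    Finsupp.mapDomain_apply (fun a b hab => by simpa [he.ne'] using hab) _ _
  have hφt : φ δ.paramT = η.paramT ^ e := Subtype.ext (by
    rw [coe_paramT_pow]
    exact (hφ1 _ 1 1 rfl).trans (by rw [mul_one]))
  rw [NoCommonPointAtInfinity, Set.eq_empty_iff_forall_notMem]
  rintro q ⟨hqX, hq⟩
  set J := q.asHomogeneousIdeal.toIdeal with hJ
  have hJp : J.IsPrime := q.isPrime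
  have hJterm := (η.isHomogeneous_iff_term_mem hη J).mp q.asHomogeneousIdeal.2
  have hs : η.paramT ∈ J := by
    by_contra hs
    exact hq (η.mem_range_psi_of_paramT_notMem hη q hs)
  have hphom : (J.comap φ).IsHomogeneous δ.piece := by
    refine (δ.isHomogeneous_iff_term_mem hδ _).mpr fun x hx i => ?_
    have h1 : φ (δ.term x i) = η.term (φ x) (e * i) := Subtype.ext (by
      rw [hφ1 _ i (x.1.coeff i) rfl]
      change _ = AddMonoidAlgebra.single _ _
      rw [hcoeff])
    rw [Ideal.mem_comap, h1]
    exact hJterm _ hx _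
  have hprel : ¬ (HomogeneousIdeal.irrelevant δ.piece).toIdeal ≤ J.comap φ := by
    intro hle
    -- a homogeneous element of degree `l > 0` of `A^ε`, where `ε = e δ`, lies in `J`, since its
    -- `e`-th power comes from a homogeneous element of degree `l` of `A^δ`
    have hpos : ∀ (y : η.gradedRing) (l : ℕ) (a : A), 0 < l →
        y.1 = AddMonoidAlgebra.single (l : ℤ) a →
        (δ.mul e he) a ≤ ((l : ℤ) : WithBot ℤ) → y ∈ J := by
      intro y l a hl hy ha
      have h1 : δ (a ^ e) ≤ ((l : ℤ) : WithBot ℤ) := (δ.map_pow_le a he).trans ha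
      have h2 : ((δ.elem l _ h1 : δ.piece l) : δ.gradedRing) ∈ J.comap φ :=
        hle (HomogeneousIdeal.mem_irrelevant_of_mem δ.piece hl (δ.elem l _ h1).2)
      refine hJp.mem_of_pow_mem e ?_
      have h3 : φ (δ.elem l _ h1) = y ^ e := Subtype.ext (by
        rw [hφ1 _ l (a ^ e) rfl]
        change _ = y.1 ^ e
        rw [hy, AddMonoidAlgebra.single_pow, nsmul_eq_mul])
      exact h3 ▸ h2
    refine q.not_irrelevant_le (HomogeneousIdeal.irrelevant_le _ |>.mpr fun d hd x hx => ?_)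
    change x ∈ J
    have hx' : x.1 = AddMonoidAlgebra.single (d : ℤ) (x.1.coeff d) :=
      LaurentPolynomial.ext fun i => by
        rw [AddMonoidAlgebra.coeff_single, Finsupp.single_apply]
        split_ifs with hi
        · rw [hi]
        · exact hx i (Ne.symm hi)
    -- in the equation `x^m + ∑ (a j t^{d (m - j)}) x^j = 0` all coefficients have positive degree
    obtain ⟨m, a, ha, hsum⟩ := (δ.mul e he).exists_equation_of_isIntegral (hx' ▸ hint.2 x.1 x.2)
    let y : ℕ → η.gradedRing := fun j =>
      if hj : j < m then
        ⟨AddMonoidAlgebra.single ((d * (m - j) : ℕ) : ℤ) (a j),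
          hsub ((δ.mul e he).single_mem_gradedRing
            ((ha j hj).trans (by push_cast [Nat.cast_sub hj.le]; rfl)))⟩
      else 0
    have h1 : x ^ m = - ∑ j ∈ Finset.range m, y j * x ^ j := by
      rw [eq_neg_iff_add_eq_zero]
      refine Subtype.ext ?_
      have h2 : (x ^ m + ∑ j ∈ Finset.range m, y j * x ^ j : η.gradedRing).1 =
          x.1 ^ m + ∑ j ∈ Finset.range m, (y j).1 * x.1 ^ j := by
        push_cast
        rfl
      rw [h2, hx', AddMonoidAlgebra.single_pow]
      have h3 : ∀ j ∈ Finset.range m,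
          (y j).1 * (AddMonoidAlgebra.single (d : ℤ) (x.1.coeff d)) ^ j =
            AddMonoidAlgebra.single (m • (d : ℤ)) (a j * x.1.coeff d ^ j) := by
        intro j hj
        have hj' := Finset.mem_range.mp hj
        have h4 : (y j).1 = AddMonoidAlgebra.single ((d * (m - j) : ℕ) : ℤ) (a j) := by
          simp only [y, dif_pos hj']
        rw [h4, AddMonoidAlgebra.single_pow, AddMonoidAlgebra.single_mul_single]
        congr 1
        push_cast [Nat.cast_sub hj'.le, nsmul_eq_mul]
        ring
      rw [Finset.sum_congr rfl h3]
      have h5 := congrArg (AddMonoidAlgebra.singleAddHom (m • (d : ℤ))) hsum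
      rw [map_add, map_sum, map_zero] at h5
      exact h5
    refine hJp.mem_of_pow_mem m ?_
    rw [h1]
    refine J.neg_mem (J.sum_mem fun j hj => J.mul_mem_right _ ?_)
    have hj' := Finset.mem_range.mp hj
    refine hpos _ (d * (m - j)) (a j) (Nat.mul_pos hd (by omega)) (by simp only [y, dif_pos hj']) ?_
    exact (ha j hj').trans (by push_cast [Nat.cast_sub hj'.le]; rfl)
  let p : δ.ProjSpace hδ :=
    { asHomogeneousIdeal := ⟨J.comap φ, hphom⟩
      isPrime := hJp.comap φ
      not_irrelevant_le := hprel }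
  refine Set.eq_empty_iff_forall_notMem.mp hX p ⟨Set.mem_iInter.mpr fun j => ?_, ?_⟩
  · -- an element of all `ψ_δ(P)`, for `P ∈ X j`, is mapped into all `ψ_η(P)`
    refine (δ.mem_closure_psi_image_iff hδ (X j) p).mpr fun x hx => ?_
    refine (η.mem_closure_psi_image_iff hη (X j) q).mp (Set.mem_iInter.mp hqX j) (φ x)
      fun P hP i => ?_
    by_cases hi : ∃ l, e * l = i
    · obtain ⟨l, rfl⟩ := hi
      rw [hcoeff]
      exact hx P hP l
    · have h1 : (φ x).1.coeff i = 0 :=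
        Finsupp.mapDomain_of_notMem_range _ _ fun ⟨l, hl⟩ => hi ⟨l, hl⟩
      rw [h1]
      exact P.asIdeal.zero_mem
  · rintro ⟨P, hP⟩
    have h1 : δ.paramT ∈ p.asHomogeneousIdeal.toIdeal := by
      change φ δ.paramT ∈ J
      rw [hφt]
      exact J.pow_mem_of_mem hs e he
    rw [← hP] at h1
    exact δ.paramT_notMem_homogenization P.asIdeal h1

end DegreeLike

end

/-! ### The normalization of a degree-like function -/

theorem mainTheorem1 {k A : Type*} [Field k] [IsAlgClosed k] [CommRing A] [IsReduced A]
    [Algebra k A] [Algebra.FiniteType k A] (δ : DegreeLike k A)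
    (hint : δ.IsIntegerValued) (hfg : δ.IsFinitelyGenerated) :
    ∃ (e : ℕ) (he : 0 < e) (η : DegreeLike k A),
      η.IsIntegerValued ∧ η.IsFinitelyGenerated ∧ η.IsQuasidegree ∧
      (IsDomain A → η.IsIntegerQuasidegree) ∧
      η.IsIntegralOver (δ.mul e he) ∧
      (∀ f : A, f ≠ 0 → ∃ d : ℤ, η f = (d : WithBot ℤ) ∧
        Filter.Tendsto (fun m : ℕ => (e : ℝ) * (((δ (f ^ m)).unbotD 0 : ℤ) : ℝ) / (m : ℝ))
          Filter.atTop (nhds (d : ℝ))) ∧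
      (∀ hδ : δ.IsNonneg, ∃ hη : η.IsNonneg, η.PreservesIntersectionsAtInfinity δ hη hδ) := by
  classical
  have : Infinite k := IsAlgClosed.instInfinite
  obtain ⟨e, he, N, σ, hσ, hσint, hiff⟩ := δ.exists_finMax_le_iff_isIntegral hfg
  obtain ⟨c, hc⟩ :=
    δ.exists_single_mul_mem_of_finite (δ.exists_valuations_isIntegral_single_iff hfg).2
  set η := DegreeLike.finMax σ with hη
  have hpow : ∀ (f : A) (m : ℕ), 0 < m → η (f ^ m) = DegreeLike.scale m (η f) :=
    fun f m hm => DegreeLike.finMax_map_pow hσ f hm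
  have hle : ∀ f, η f ≤ δ.mul e he f := by
    intro f
    by_cases hf : f = 0
    · rw [hf, η.apply_zero]
      exact bot_le
    obtain ⟨a, ha⟩ := WithBot.ne_bot_iff_exists.mp (hint f hf)
    have h1 : δ.mul e he f = ((e * a : ℤ) : WithBot ℤ) := by
      change DegreeLike.scale e (δ f) = _
      rw [← ha, DegreeLike.scale_coe]
    rw [h1, hiff]
    exact isIntegral_algebraMap (R := δ.gradedRing)
      (x := ⟨_, δ.single_mem_gradedRing (show δ f ≤ (a : WithBot ℤ) from ha.ge)⟩)
  -- if `f t^i` is integral, then `f t^(c + i)` lies in `A^δ`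
  have hcond : ∀ (f : A) (i : ℤ), η f ≤ ((e * i : ℤ) : WithBot ℤ) →
      δ f ≤ ((c + i : ℤ) : WithBot ℤ) := by
    intro f i hf
    have h1 := hc _ ((hiff f i).mp hf) (c + i)
    rwa [AddMonoidAlgebra.single_mul_single, one_mul, AddMonoidAlgebra.coeff_single,
      Finsupp.single_eq_same] at h1
  have hηint : η.IsIntegerValued := by
    intro f hf h0
    obtain ⟨a, ha⟩ := WithBot.ne_bot_iff_exists.mp (hint f hf)
    -- otherwise `δ f ≤ i` for all integers `i`
    have h1 := hcond f (a - c - 1) (h0.le.trans bot_le)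
    rw [← ha, WithBot.coe_le_coe] at h1
    omega
  have hN : ∀ f, δ.mul e he f ≤ η f + (((e * (c + 1) : ℕ) : ℤ) : WithBot ℤ) := by
    intro f
    by_cases hf : f = 0
    · rw [hf, (δ.mul e he).apply_zero]
      exact bot_le
    obtain ⟨d, hd⟩ := WithBot.ne_bot_iff_exists.mp (hηint f hf)
    have hdm := Int.emod_add_mul_ediv d e
    have hr0 := Int.emod_nonneg d (b := e) (by omega)
    have hr1 := Int.emod_lt_of_pos d (b := e) (by omega)
    -- `e (⌊d/e⌋ + 1)` is a multiple of `e` above `d`, by at most `e`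
    have h1 := hcond f (d / e + 1) (by
      rw [← hd, WithBot.coe_le_coe]
      linarith)
    refine ((DegreeLike.scale_strictMono he).monotone h1).trans ?_
    rw [← hd, DegreeLike.scale_coe, ← WithBot.coe_add, WithBot.coe_le_coe]
    push_cast
    linarith
  have hNpos : Nontrivial A → 0 < N := by
    intro _
    refine Nat.pos_of_ne_zero fun h0 => hηint 1 one_ne_zero ?_
    subst h0
    rw [hη, DegreeLike.finMax_apply, Finset.univ_eq_empty, Finset.sup_empty]
  obtain ⟨hover, hηfg⟩ := DegreeLike.isIntegralOver_and_isFinitelyGenerated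
    (DegreeLike.mul_isFinitelyGenerated hfg he) hle hN
  refine ⟨e, he, η, hηint, hηfg, ?_, fun hA => ?_, hover, fun f hf => ?_, fun hδ => ?_⟩
  · -- over the zero ring there may be no semidegree in the family; the constant `-∞` serves
    cases subsingleton_or_nontrivial A with
    | inl _ =>
      refine ⟨1, fun _ => DegreeLike.constBot k A, one_pos, fun _ _ _ => rfl, fun f => ?_⟩
      rw [Subsingleton.elim f 0, η.apply_zero]
      exact (Finset.sup_bot _).symm
    | inr h => exact ⟨N, σ, hNpos h, hσ, fun _ => rfl⟩
  · exact ⟨N, σ, hNpos inferInstance, fun j => ⟨hσ j, hσint hA j⟩, fun _ => rfl⟩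
  · obtain ⟨d, hd⟩ := WithBot.ne_bot_iff_exists.mp (hηint f hf)
    exact ⟨d, hd.symm, DegreeLike.tendsto_of_power_homogeneous he hint hpow hle hN hf hd.symm⟩
  · have hη0 := DegreeLike.isNonneg_of_power_homogeneous he hpow hN hδ
    exact ⟨hη0, DegreeLike.preservesIntersectionsAtInfinity_of_isIntegralOver he hη0 hδ hover⟩
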